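/- Conventions. $R$ and $S$ are associative rings with unit, modules are unital left modules, and right $R$-modules are modules over $R^{op}$. Let $A$ be a ring and let $n,d\ge 0$ be integers. An $A$-module $U$ is *finitely $n$-presented* if there is an exact sequence $F_n\to\cdots\to F_1\to F_0\to U\to 0$ with every $F_i$ finitely generated and free. It is *super finitely presented* if there is an exact sequence $\cdots\to F_1\to F_0\to U\to 0$ with every $F_i$ finitely generated and free. For such an infinite sequence and $d\ge 1$, the $(d-1)$th syzygy of $U$ is $\mathrm{Ker}(F_{d-1}\to F_{d-2})$, where $F_{-1}=U$. An $A$-module $M$ is *$(n,d)$-injective*, written $M\in\mathcal I^{(n,d)}(A)$, if $\mathrm{Ext}_A^{d+1}(U,M)=0$ for every finitely $n$-presented $A$-module $U$. An $A$-module $N$ is *$(n,d)$-flat*, written $N\in\mathcal F^{(n,d)}(A)$, if $\mathrm{Tor}^A_{d+1}(U,N)=0$ for every finitely $n$-presented $A^{op}$-module $U$. An $(S,R)$-bimodule $K={}_SK_R$ is *semidualizing* if ${}_SK$ and $K_R$ each have a projective resolution by finitely generated projective modules, the homothety maps $S\to\mathrm{Hom}_{R^{op}}(K,K)$ and $R\to\mathrm{Hom}_S(K,K)$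 are bijective, and $\mathrm{Ext}^i_S(K,K)=0=\mathrm{Ext}^i_{R^{op}}(K,K)$ for all $i\ge 1$. The *Auslander class* $\mathcal A_K(R)$ consists of the $R$-modules $M$ such that $\mathrm{Tor}^R_i(K,M)=0$ and $\mathrm{Ext}^i_S(K,K\otimes_RM)=0$ for all $i\ge1$ and the natural map $M\to\mathrm{Hom}_S(K,K\otimes_RM)$, $m\mapsto(x\mapsto x\otimes m)$, is an isomorphism. The *Bass class* $\mathcal B_K(S)$ consists of the $S$-modules $N$ such that $\mathrm{Ext}_S^i(K,N)=0$ and $\mathrm{Tor}^R_i(K,\mathrm{Hom}_S(K,N))=0$ for all $i\ge 1$ and the natural map $K\otimes_R\mathrm{Hom}_S(K,N)\to N$, $x\otimes f\mapsto f(x)$, is an isomorphism. Now let $d\ge 1$ and $n>d+1$. Let $C$ be an $(S,R)$-bimodule that is super finitely presented as a left $S$-module and as a right $R$-module. Let $K_{d-1}$ be an $(S,R)$-bimodule that is *special semidualizing with respect to $C$*: it is semidualizing, and it is isomorphic, as a left $S$-module and as a right $R$-module respectively, to a $(d-1)$th syzygy of ${}_SC$ and to a $(d-1)$th syzygy of $C_R$.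 (For instance, $K_{d-1}$ may be the $(d-1)$th syzygy in an exact sequence of bimodules $\cdots\to F_1\to F_0\to C\to0$ whose terms are finitely generated and free on both sides, provided that this syzygy is semidualizing.) An $R$-module $M$ is *$K_{d-1}$-$(n,d)$-injective* if $M\cong\mathrm{Hom}_S(K_{d-1},I)$ as $R$-modules for some $I\in\mathcal I^{(n,d)}(S)$. An $S$-module $N$ is *$K_{d-1}$-$(n,d)$-flat* if $N\cong K_{d-1}\otimes_RF$ as $S$-modules for some $F\in\mathcal F^{(n,d)}(R)$. **Proposition.** (1) An $R$-module $M$ is $K_{d-1}$-$(n,d)$-injective if and only if $M\in\mathcal A_{K_{d-1}}(R)$ and $K_{d-1}\otimes_RM\in\mathcal I^{(n,d)}(S)$. (2) An $S$-module $N$ is $K_{d-1}$-$(n,d)$-flat if and only if $N\in\mathcal B_{K_{d-1}}(S)$ and $\mathrm{Hom}_S(K_{d-1},N)\in\mathcal F^{(n,d)}(R)$. -/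

import Mathlib

universe u

namespace FoxbyND

open CategoryTheory TensorProduct

/-! Conventions. Modules are left modules; a right `R`-module is a module over `Rᵐᵒᵖ`, with
`x r = MulOpposite.op r • x`. An `(S, R)`-bimodule is an abelian group `K` with `Module S K`,
`Module Rᵐᵒᵖ K` and `SMulCommClass S Rᵐᵒᵖ K`. -/

section Tensor

/-- The subgroup of `K ⊗[ℤ] M` generated by the elements `x r ⊗ m - x ⊗ r m`. -/
def balancedSubgroup (R : Type u) [Ring R] (K : Type u) [AddCommGroup K] [Module Rᵐᵒᵖ K]
    (M : Type u) [AddCommGroup M] [Module R M] : AddSubgroup (K ⊗[ℤ] M) :=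
  AddSubgroup.closure
    {z | ∃ (x : K) (r : R) (m : M), z = (MulOpposite.op r • x) ⊗ₜ[ℤ] m - x ⊗ₜ[ℤ] (r • m)}

/-- The tensor product `K ⊗_R M` of a right `R`-module `K` and a left `R`-module `M`. -/
def RTensor (R : Type u) [Ring R] (K : Type u) [AddCommGroup K] [Module Rᵐᵒᵖ K]
    (M : Type u) [AddCommGroup M] [Module R M] : Type u :=
  (K ⊗[ℤ] M) ⧸ balancedSubgroup R K M

namespace RTensor

variable (R : Type u) [Ring R] (S : Type u) [Ring S]
variable {K : Type u} [AddCommGroup K] [Module Rᵐᵒᵖ K]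
variable {K' : Type u} [AddCommGroup K'] [Module Rᵐᵒᵖ K']
variable {M : Type u} [AddCommGroup M] [Module R M]

noncomputable instance : AddCommGroup (RTensor R K M) :=
  inferInstanceAs (AddCommGroup ((K ⊗[ℤ] M) ⧸ balancedSubgroup R K M))

/-- The projection `K ⊗[ℤ] M → K ⊗_R M`. -/
noncomputable def proj : K ⊗[ℤ] M →+ RTensor R K M :=
  QuotientAddGroup.mk' (balancedSubgroup R K M)

theorem proj_surjective : Function.Surjective (proj R : K ⊗[ℤ] M →+ RTensor R K M) :=
  QuotientAddGroup.mk'_surjective _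

/-- The element `x ⊗ m` of `K ⊗_R M`. -/
noncomputable def tmul (x : K) (m : M) : RTensor R K M := proj R (x ⊗ₜ[ℤ] m)

theorem smul_tmul (r : R) (x : K) (m : M) :
    tmul R (MulOpposite.op r • x) m = tmul R x (r • m) := by
  rw [← sub_eq_zero, tmul, tmul, ← map_sub]
  exact (QuotientAddGroup.eq_zero_iff _).2 (AddSubgroup.subset_closure ⟨x, r, m, rfl⟩)

theorem tmul_add (x : K) (m m' : M) : tmul R x (m + m') = tmul R x m + tmul R x m' := by
  simp only [tmul, TensorProduct.tmul_add, map_add]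

theorem add_tmul (x x' : K) (m : M) : tmul R (x + x') m = tmul R x m + tmul R x' m := by
  simp only [tmul, TensorProduct.add_tmul, map_add]

/-- Two additive maps out of `K ⊗_R M` agree if they agree on all `x ⊗ m`. -/
theorem addHom_ext {A : Type*} [AddCommGroup A] {f g : RTensor R K M →+ A}
    (h : ∀ (x : K) (m : M), f (tmul R x m) = g (tmul R x m)) : f = g := by
  ext z
  obtain ⟨t, rfl⟩ := proj_surjective R z
  induction t with
  | zero => simp
  | tmul x m => exact h x m
  | add a b ha hb => simp only [map_add, ha, hb]

/-- The additive map `K ⊗_R M → A` induced by a balanced biadditive map `K × M → A`. -/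
noncomputable def lift {A : Type*} [AddCommGroup A] (f : K →+ M →+ A)
    (hf : ∀ (r : R) (x : K) (m : M), f (MulOpposite.op r • x) m = f x (r • m)) :
    RTensor R K M →+ A :=
  QuotientAddGroup.lift (balancedSubgroup R K M)
    (TensorProduct.liftAddHom f (fun n x m => by simp))
    (by
      rw [balancedSubgroup, AddSubgroup.closure_le]
      rintro _ ⟨x, r, m, rfl⟩
      simp [hf])

theorem lift_tmul {A : Type*} [AddCommGroup A] (f : K →+ M →+ A)
    (hf : ∀ (r : R) (x : K) (m : M), f (MulOpposite.op r • x) m = f x (r • m))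
    (x : K) (m : M) : lift R f hf (tmul R x m) = f x m := rfl

/-- The map `φ ⊗_R M : K ⊗_R M → K' ⊗_R M` induced by a map `φ : K → K'` of right modules. -/
noncomputable def map (φ : K →ₗ[Rᵐᵒᵖ] K') : RTensor R K M →+ RTensor R K' M :=
  lift R
    { toFun := fun x =>
        { toFun := fun m => tmul R (φ x) m
          map_zero' := by simp [tmul]
          map_add' := fun m m' => tmul_add R _ m m' }
      map_zero' := by ext m; simp [tmul]
      map_add' := fun x x' => by ext m; simp [add_tmul] }
    (fun r x m => by simp [smul_tmul])

theorem map_tmul (φ : K →ₗ[Rᵐᵒᵖ] K') (x : K) (m : M) :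
    map R φ (tmul R x m) = tmul R (φ x) m := rfl

variable [Module S K] [SMulCommClass S Rᵐᵒᵖ K]

/-- The left action on `K ⊗_R M` for an `(S, R)`-bimodule `K`: `s (x ⊗ m) = (s x) ⊗ m`. -/
noncomputable instance : SMul S (RTensor R K M) :=
  ⟨fun s => map R
    { toFun := fun x => s • x
      map_add' := smul_add s
      map_smul' := fun r x => smul_comm s r x }⟩

theorem smul_tmul_left (s : S) (x : K) (m : M) : s • tmul R x m = tmul R (s • x) m := rfl

theorem induction_on {p : RTensor R K M → Prop} (z : RTensor R K M) (h0 : p 0)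
    (ht : ∀ (x : K) (m : M), p (tmul R x m)) (ha : ∀ a b, p a → p b → p (a + b)) : p z := by
  obtain ⟨t, rfl⟩ := proj_surjective R z
  induction t with
  | zero => simpa using h0
  | tmul x m => exact ht x m
  | add a b ha' hb' => rw [map_add]; exact ha _ _ ha' hb'

protected theorem smul_add' (s : S) (a b : RTensor R K M) : s • (a + b) = s • a + s • b :=
  map_add (map R _) a b

protected theorem smul_zero' (s : S) : s • (0 : RTensor R K M) = 0 := map_zero (map R _)

noncomputable instance : Module S (RTensor R K M) where
  smul_add := RTensor.smul_add' R S
  smul_zero := RTensor.smul_zero' R S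
  one_smul z := by
    induction z using induction_on with
    | h0 => exact RTensor.smul_zero' R S _
    | ht x m => rw [smul_tmul_left, one_smul]
    | ha a b ha hb => rw [RTensor.smul_add', ha, hb]
  mul_smul s t z := by
    induction z using induction_on with
    | h0 => simp only [RTensor.smul_zero']
    | ht x m => simp only [smul_tmul_left, mul_smul]
    | ha a b ha hb => simp only [RTensor.smul_add', ha, hb]
  add_smul s t z := by
    induction z using induction_on with
    | h0 => simp only [RTensor.smul_zero', add_zero]
    | ht x m => simp only [smul_tmul_left, add_smul, add_tmul]
    | ha a b ha hb => simp only [RTensor.smul_add', ha, hb]; abel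
  zero_smul z := by
    induction z using induction_on with
    | h0 => exact RTensor.smul_zero' R S _
    | ht x m => rw [smul_tmul_left, zero_smul, tmul, TensorProduct.zero_tmul, map_zero]
    | ha a b ha hb => rw [RTensor.smul_add', ha, hb, add_zero]

end RTensor

end Tensor

section Tor

variable (R : Type u) [Ring R] (M : Type u) [AddCommGroup M] [Module R M]

/-- The functor `- ⊗_R M` from right `R`-modules to abelian groups. -/
noncomputable def tensorFunctor : ModuleCat.{u} Rᵐᵒᵖ ⥤ AddCommGrpCat.{u} where
  obj U := AddCommGrpCat.of (RTensor R U M)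
  map φ := AddCommGrpCat.ofHom (RTensor.map R φ.hom)
  map_id U := by
    ext1
    exact RTensor.addHom_ext R fun x m => rfl
  map_comp φ ψ := by
    ext1
    exact RTensor.addHom_ext R fun x m => rfl

instance : (tensorFunctor R M).Additive where
  map_add {U V φ ψ} := by
    ext1
    exact RTensor.addHom_ext R fun x m => RTensor.add_tmul R (φ.hom x) (ψ.hom x) m

/-- `Tor_i^R(U, M)`, the `i`-th left derived functor of `- ⊗_R M` at the right `R`-module `U`. -/
noncomputable def Tor (i : ℕ) (U : Type u) [AddCommGroup U] [Module Rᵐᵒᵖ U] : AddCommGrpCat.{u} :=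
  ((tensorFunctor R M).leftDerived i).obj (ModuleCat.of Rᵐᵒᵖ U)

end Tor

/-- `Ext^i_A(U, M)`. -/
abbrev Ext (A : Type u) [Ring A] (i : ℕ) (U : Type u) [AddCommGroup U] [Module A U]
    (M : Type u) [AddCommGroup M] [Module A M] : Type u :=
  Abelian.Ext (ModuleCat.of A U) (ModuleCat.of A M) i

section Hom

/-- The group `Hom_S(K, N)`, regarded as a left `R`-module when `K` is an `(S, R)`-bimodule,
by `(r f)(x) = f(x r)`. -/
def BHom (S : Type u) [Ring S] (K : Type u) [AddCommGroup K] [Module S K]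
    (N : Type u) [AddCommGroup N] [Module S N] : Type u :=
  K →ₗ[S] N

variable (R : Type u) [Ring R] (S : Type u) [Ring S]
variable (K : Type u) [AddCommGroup K] [Module S K] [Module Rᵐᵒᵖ K] [SMulCommClass S Rᵐᵒᵖ K]
variable (N : Type u) [AddCommGroup N] [Module S N]

instance : AddCommGroup (BHom S K N) := inferInstanceAs (AddCommGroup (K →ₗ[S] N))

instance : FunLike (BHom S K N) K N := inferInstanceAs (FunLike (K →ₗ[S] N) K N)

instance : Module R (BHom S K N) where
  smul r f :=
    { toFun := fun x => f (MulOpposite.op r • x)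
      map_add' := fun x y => by rw [smul_add]; exact LinearMap.map_add f _ _
      map_smul' := fun s x => by
        rw [← smul_comm s (MulOpposite.op r) x]; exact LinearMap.map_smul f _ _ }
  one_smul f := LinearMap.ext fun x => congrArg f (one_smul Rᵐᵒᵖ x)
  mul_smul r r' f := LinearMap.ext fun x => congrArg f (mul_smul (MulOpposite.op r') _ x)
  smul_zero r := rfl
  smul_add r f g := rfl
  add_smul r r' f := LinearMap.ext fun x =>
    (congrArg f (add_smul (MulOpposite.op r) (MulOpposite.op r') x)).trans
      (LinearMap.map_add f _ _)
  zero_smul f := LinearMap.ext fun x =>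
    (congrArg f (zero_smul Rᵐᵒᵖ x)).trans (LinearMap.map_zero f)

theorem BHom.smul_apply (r : R) (f : BHom S K N) (x : K) :
    (r • f) x = f (MulOpposite.op r • x) := rfl

/-- The natural map `μ : M → Hom_S(K, K ⊗_R M)`, `μ m = (x ↦ x ⊗ m)`. -/
noncomputable def evalMu (M : Type u) [AddCommGroup M] [Module R M] :
    M →ₗ[R] BHom S K (RTensor R K M) where
  toFun m :=
    { toFun := fun x => RTensor.tmul R x m
      map_add' := fun x y => RTensor.add_tmul R x y m
      map_smul' := fun _ _ => rfl }
  map_add' m m' := LinearMap.ext fun x => RTensor.tmul_add R x m m'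
  map_smul' r m := LinearMap.ext fun x => (RTensor.smul_tmul R r x m).symm

/-- The natural evaluation map `ν : K ⊗_R Hom_S(K, N) → N`, `ν (x ⊗ f) = f x`. -/
noncomputable def evalNu : RTensor R K (BHom S K N) →ₗ[S] N :=
  let e : RTensor R K (BHom S K N) →+ N := RTensor.lift R
    { toFun := fun x =>
        { toFun := fun f => f x
          map_zero' := rfl
          map_add' := fun _ _ => rfl }
      map_zero' := by ext f; exact LinearMap.map_zero f
      map_add' := fun x y => by ext f; exact LinearMap.map_add f x y }
    (fun r x f => rfl)
  { toFun := e
    map_add' := e.map_add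
    map_smul' := fun s z => by
      induction z using RTensor.induction_on with
      | h0 => simp
      | ht x f => exact LinearMap.map_smul f s x
      | ha a b ha hb => simp only [smul_add, map_add, ha, hb] }

end Hom

section Finiteness

variable (A : Type u) [Ring A]

/-- `U` is finitely `n`-presented: there is an exact sequence
`Fₙ → ⋯ → F₁ → F₀ → U → 0` with `Fᵢ = A ^ kᵢ` (the data in degrees `> n` is arbitrary). -/
def IsFinitelyPresentedOfLength (n : ℕ) (U : Type u) [AddCommGroup U] [Module A U] : Prop :=
  ∃ (k : ℕ → ℕ) (δ : ∀ i, (Fin (k (i + 1)) → A) →ₗ[A] (Fin (k i) → A))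
    (ε : (Fin (k 0) → A) →ₗ[A] U),
    Function.Surjective ε ∧
    (0 < n → Function.Exact (δ 0) ε) ∧
    ∀ i, i + 1 < n → Function.Exact (δ (i + 1)) (δ i)

/-- An exact sequence `⋯ → F₂ → F₁ → F₀ → C → 0` with each `Fᵢ = A ^ kᵢ` finitely generated free.
A module is super finitely presented if it has one. -/
structure FiniteFreeResolution (C : Type u) [AddCommGroup C] [Module A C] where
  /-- the ranks -/
  k : ℕ → ℕ
  /-- the differentials `F_{i+1} → F_i` -/
  δ : ∀ i, (Fin (k (i + 1)) → A) →ₗ[A] (Fin (k i) → A)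
  /-- the augmentation `F_0 → C` -/
  ε : (Fin (k 0) → A) →ₗ[A] C
  surjective : Function.Surjective ε
  exact_zero : Function.Exact (δ 0) ε
  exact_succ : ∀ i, Function.Exact (δ (i + 1)) (δ i)

/-- `K` is isomorphic to the `(d-1)`-th syzygy of the resolution, that is, to
`Ker (F_{d-1} → F_{d-2})`, where `F_{-1} = C`; for `d = 0` the convention is `K_{-1} = C`. -/
def FiniteFreeResolution.IsSyzygy {A : Type u} [Ring A] {C : Type u} [AddCommGroup C] [Module A C]
    (F : FiniteFreeResolution A C) (d : ℕ) (K : Type u) [AddCommGroup K] [Module A K] : Prop :=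
  match d with
  | 0 => Nonempty (K ≃ₗ[A] C)
  | 1 => Nonempty (K ≃ₗ[A] LinearMap.ker F.ε)
  | d + 2 => Nonempty (K ≃ₗ[A] LinearMap.ker (F.δ d))

/-- `C` has a projective resolution by finitely generated projective modules. -/
def HasFiniteProjectiveResolution (C : Type u) [AddCommGroup C] [Module A C] : Prop :=
  ∃ P : ProjectiveResolution (ModuleCat.of A C), ∀ i, Module.Finite A (P.complex.X i)

end Finiteness

section Classes

/-- `M` is an `(n, d)`-injective left `A`-module. -/
def IsNDInjective (A : Type u) [Ring A] (n d : ℕ) (M : Type u) [AddCommGroup M] [Module A M] :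
    Prop :=
  ∀ (U : Type u) [AddCommGroup U] [Module A U],
    IsFinitelyPresentedOfLength A n U → Subsingleton (Ext A (d + 1) U M)

/-- `N` is an `(n, d)`-flat left `A`-module. -/
def IsNDFlat (A : Type u) [Ring A] (n d : ℕ) (N : Type u) [AddCommGroup N] [Module A N] :
    Prop :=
  ∀ (U : Type u) [AddCommGroup U] [Module Aᵐᵒᵖ U],
    IsFinitelyPresentedOfLength Aᵐᵒᵖ n U → Subsingleton (Tor A N (d + 1) U)

variable (S R : Type u) [Ring S] [Ring R]
variable (K : Type u) [AddCommGroup K] [Module S K] [Module Rᵐᵒᵖ K] [SMulCommClass S Rᵐᵒᵖ K]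

/-- The homothety map `S → Hom_{Rᵒᵖ}(K, K)`, `s ↦ (x ↦ s x)`. -/
def homothetyLeft (s : S) : K →ₗ[Rᵐᵒᵖ] K where
  toFun x := s • x
  map_add' := smul_add s
  map_smul' r x := smul_comm s r x

/-- The homothety map `R → Hom_S(K, K)`, `r ↦ (x ↦ x r)`. -/
def homothetyRight (r : R) : K →ₗ[S] K where
  toFun x := MulOpposite.op r • x
  map_add' := smul_add (MulOpposite.op r)
  map_smul' s x := (smul_comm s (MulOpposite.op r) x).symm

/-- The `(S, R)`-bimodule `K` is semidualizing. -/
structure IsSemidualizing : Prop where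
  a₁ : HasFiniteProjectiveResolution S K
  a₂ : HasFiniteProjectiveResolution Rᵐᵒᵖ K
  b₁ : Function.Bijective (homothetyLeft S R K)
  b₂ : Function.Bijective (homothetyRight S R K)
  c₁ : ∀ i, 1 ≤ i → Subsingleton (Ext S i K K)
  c₂ : ∀ i, 1 ≤ i → Subsingleton (Ext Rᵐᵒᵖ i K K)

/-- `K = K_{d-1}` is a special semidualizing bimodule with respect to the `(S, R)`-bimodule `C`:
`C` is super finitely presented as a left `S`-module and as a right `R`-module, `K` is on each side
a `(d-1)`-th syzygy of `C`, and `K` is semidualizing. (If `K` is the kernel of `F_{d-1} → F_{d-2}`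
in an exact sequence of bimodules `⋯ → F₁ → F₀ → C → 0` whose terms are finitely generated free on
both sides, then the two resolutions may be taken to be this one.) -/
structure IsSpecialSemidualizing (d : ℕ) (C : Type u) [AddCommGroup C] [Module S C]
    [Module Rᵐᵒᵖ C] [SMulCommClass S Rᵐᵒᵖ C] : Prop where
  left : ∃ F : FiniteFreeResolution S C, F.IsSyzygy d K
  right : ∃ F : FiniteFreeResolution Rᵐᵒᵖ C, F.IsSyzygy d K
  semidualizing : IsSemidualizing S R K

/-- The Auslander class `A_K(R)`. -/
structure InAuslanderClass (M : Type u) [AddCommGroup M] [Module R M] : Prop where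
  A₁ : ∀ i, 1 ≤ i → Subsingleton (Tor R M i K)
  A₂ : ∀ i, 1 ≤ i → Subsingleton (Ext S i K (RTensor R K M))
  A₃ : Function.Bijective (evalMu R S K M)

/-- The Bass class `B_K(S)`. -/
structure InBassClass (N : Type u) [AddCommGroup N] [Module S N] : Prop where
  B₁ : ∀ i, 1 ≤ i → Subsingleton (Ext S i K N)
  B₂ : ∀ i, 1 ≤ i → Subsingleton (Tor R (BHom S K N) i K)
  B₃ : Function.Bijective (evalNu R S K N)

/-- The left `R`-module `M` is `K`-`(n, d)`-injective: `M ≅ Hom_S(K, I)` for some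
`(n, d)`-injective left `S`-module `I`. -/
def IsKNDInjective (n d : ℕ) (M : Type u) [AddCommGroup M] [Module R M] : Prop :=
  ∃ (I : Type u) (_ : AddCommGroup I) (_ : Module S I),
    IsNDInjective S n d I ∧ Nonempty (M ≃ₗ[R] BHom S K I)

/-- The left `S`-module `N` is `K`-`(n, d)`-flat: `N ≅ K ⊗_R F` for some
`(n, d)`-flat left `R`-module `F`. -/
def IsKNDFlat (n d : ℕ) (N : Type u) [AddCommGroup N] [Module S N] : Prop :=
  ∃ (F : Type u) (_ : AddCommGroup F) (_ : Module R F),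
    IsNDFlat R n d F ∧ Nonempty (N ≃ₗ[S] RTensor R K F)

end Classes

end FoxbyND

/-! Everything rests on two inclusions: $(n,d)$-injective $S$-modules lie in the Bass class of $K$,
and $(n,d)$-flat $R$-modules lie in its Auslander class. Given these, the Foxby equivalence between
the two classes, a formal consequence of the triangle identities for $\otimes$ and Hom, yields both
statements.

For the first inclusion let $I$ be $(n,d)$-injective. Since $K$ lies $d$ kernels deep in a
resolution of $C$, $\mathrm{Ext}^i_S(K,I)$ is $\mathrm{Ext}^{i+d}_S(C,I)$, which vanishes for
$i\ge1$ because every syzygy of $C$ is of type $FP_\infty$. Take a finite free resolution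
$P_\bullet$ of $K_R$. By the homothety isomorphism and $\mathrm{Ext}_{R^{op}}^{\ge1}(K,K)=0$, the
sequence $0\to S\to\mathrm{Hom}(P_0,K)\to\mathrm{Hom}(P_1,K)\to\cdots$ is exact; its terms after $S$
are finite powers of $K$. All images are again $FP_\infty$, and $\mathrm{Ext}^1$ of one image into
$I$ is shifted up to $\mathrm{Ext}^{d+1}$ of a later image, which is zero. So $\mathrm{Hom}_S(-,I)$
keeps the sequence exact (`exists_extension_of_exact_sequence`, `cores_dual_exact`). As
$\mathrm{Hom}_S(\mathrm{Hom}_{R^{op}}(P,K),I)\cong P\otimes_R\mathrm{Hom}_S(K,I)$ for finite free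
$P$, this exactness is the vanishing of Tor together with the bijectivity of $\nu$.

The flat case is the mirror image: `tensor_exact_iff` and `tor_subsingleton_iff` replace $F$ by its
character module $F^+$, an $R^{op}$-module with the required Ext vanishing, and the same
coresolution argument runs with the two sides of $K$ exchanged. -/

namespace FoxbyND

open CategoryTheory TensorProduct

/-! ### Vanishing of Ext along short exact sequences -/

section ExtShortExact

variable {A : Type u} [Ring A]
variable {X Y Z : Type u} [AddCommGroup X] [Module A X] [AddCommGroup Y] [Module A Y]
  [AddCommGroup Z] [Module A Z] (I : Type u) [AddCommGroup I] [Module A I]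
variable {f : X →ₗ[A] Y} {g : Y →ₗ[A] Z}

theorem shortExact_moduleCat (hf : Function.Injective f) (hg : Function.Surjective g)
    (h : Function.Exact f g) :
    (ShortComplex.mk (ModuleCat.ofHom f) (ModuleCat.ofHom g)
      (by ext x; exact h.apply_apply_eq_zero x)).ShortExact :=
  { exact := (ShortComplex.ShortExact.moduleCat_exact_iff_function_exact _).2 h
    mono_f := (ModuleCat.mono_iff_injective _).2 hf
    epi_g := (ModuleCat.epi_iff_surjective _).2 hg }

/-- This and the next two lemmas are three segments of the long exact Ext sequence in the first
variable: two vanishing neighbours kill the group between them. -/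
theorem ext_subsingleton_right (hf : Function.Injective f) (hg : Function.Surjective g)
    (h : Function.Exact f g) {i : ℕ} (hX : Subsingleton (Ext A i X I))
    (hY : Subsingleton (Ext A (i + 1) Y I)) : Subsingleton (Ext A (i + 1) Z I) := by
  refine subsingleton_of_forall_eq 0 fun x => ?_
  obtain ⟨y, rfl⟩ := Abelian.Ext.contravariant_sequence_exact₃
    (shortExact_moduleCat hf hg h) (ModuleCat.of A I) x (hY.elim _ _) (add_comm 1 i)
  rw [hX.elim y 0, Abelian.Ext.comp_zero]

theorem ext_subsingleton_left (hf : Function.Injective f) (hg : Function.Surjective g)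
    (h : Function.Exact f g) {i : ℕ} (hY : Subsingleton (Ext A i Y I))
    (hZ : Subsingleton (Ext A (i + 1) Z I)) : Subsingleton (Ext A i X I) := by
  refine subsingleton_of_forall_eq 0 fun x => ?_
  obtain ⟨y, rfl⟩ := Abelian.Ext.contravariant_sequence_exact₁
    (shortExact_moduleCat hf hg h) (ModuleCat.of A I) x (add_comm 1 i) (hZ.elim _ _)
  rw [hY.elim y 0, Abelian.Ext.comp_zero]

theorem ext_subsingleton_middle (hf : Function.Injective f) (hg : Function.Surjective g)
    (h : Function.Exact f g) {i : ℕ} (hX : Subsingleton (Ext A i X I))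
    (hZ : Subsingleton (Ext A i Z I)) : Subsingleton (Ext A i Y I) := by
  refine subsingleton_of_forall_eq 0 fun x => ?_
  obtain ⟨y, rfl⟩ := Abelian.Ext.contravariant_sequence_exact₂
    (shortExact_moduleCat hf hg h) (ModuleCat.of A I) x (hX.elim _ _)
  rw [hZ.elim y 0, Abelian.Ext.comp_zero]

/-- Maps `X → I` extend along `X → Y` if `Ext¹(Z, I) = 0`. -/
theorem exists_extension_of_ext_one (hf : Function.Injective f) (hg : Function.Surjective g)
    (h : Function.Exact f g) (hZ : Subsingleton (Ext A 1 Z I)) (φ : X →ₗ[A] I) :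
    ∃ ψ : Y →ₗ[A] I, ψ ∘ₗ f = φ := by
  obtain ⟨y, hy⟩ := Abelian.Ext.contravariant_sequence_exact₁
    (shortExact_moduleCat hf hg h) (ModuleCat.of A I) (Abelian.Ext.mk₀ (ModuleCat.ofHom φ))
    (add_zero 1) (hZ.elim _ _)
  obtain ⟨ψ, rfl⟩ := Abelian.Ext.addEquiv₀.symm.surjective y
  refine ⟨ψ.hom, ?_⟩
  have := Abelian.Ext.addEquiv₀.symm.injective (a₁ := ModuleCat.ofHom f ≫ ψ)
    (a₂ := ModuleCat.ofHom φ) (by simpa using hy)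
  exact congrArg ModuleCat.Hom.hom this

/-- As $\mathrm{Ext}^1(Y,I)=0$, every class in $\mathrm{Ext}^1(Z,I)$ is the extension class composed
with some $\varphi:X\to I$. If $\varphi$ factors through $f$, the composite is zero, because the
extension class composed with $f$ is. -/
theorem ext_one_subsingleton_of_extension (hf : Function.Injective f)
    (hg : Function.Surjective g) (h : Function.Exact f g) (hY : Subsingleton (Ext A 1 Y I))
    (H : ∀ φ : X →ₗ[A] I, ∃ ψ : Y →ₗ[A] I, ψ ∘ₗ f = φ) : Subsingleton (Ext A 1 Z I) := by
  refine subsingleton_of_forall_eq 0 fun x => ?_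
  obtain ⟨y, rfl⟩ := Abelian.Ext.contravariant_sequence_exact₃
    (shortExact_moduleCat hf hg h) (ModuleCat.of A I) x (hY.elim _ _) (add_zero 1)
  obtain ⟨φ, rfl⟩ := Abelian.Ext.addEquiv₀.symm.surjective y
  obtain ⟨ψ, hψ⟩ := H φ.hom
  have : φ = ModuleCat.ofHom f ≫ ModuleCat.ofHom ψ := by
    ext x; exact (LinearMap.congr_fun hψ x).symm
  subst this
  have key := (shortExact_moduleCat hf hg h).extClass_comp_assoc
    (Abelian.Ext.mk₀ (ModuleCat.ofHom ψ)) (h := add_zero 1)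
  rw [Abelian.Ext.mk₀_comp_mk₀] at key
  exact key

theorem ext_subsingleton_of_projective (P : Type u) [AddCommGroup P] [Module A P]
    [Module.Projective A P] (i : ℕ) (hi : 1 ≤ i) : Subsingleton (Ext A i P I) := by
  obtain ⟨i, rfl⟩ := Nat.exists_eq_add_of_le' hi
  have : Projective (ModuleCat.of A P) := (IsProjective.iff_projective P).1 inferInstance
  exact Abelian.Ext.subsingleton_of_projective _ _ i

theorem ext_congr_left (e : X ≃ₗ[A] Y) (i : ℕ) (hX : Subsingleton (Ext A i X I)) :
    Subsingleton (Ext A i Y I) := by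
  refine subsingleton_of_forall_eq 0 fun y => ?_
  have : y = (Abelian.Ext.mk₀ e.toModuleIso.inv).comp
      ((Abelian.Ext.mk₀ e.toModuleIso.hom).comp y (zero_add i)) (zero_add i) := by
    rw [Abelian.Ext.mk₀_comp_mk₀_assoc, Iso.inv_hom_id, Abelian.Ext.mk₀_id_comp]
  rw [this, hX.elim (Abelian.Ext.comp _ y _) 0, Abelian.Ext.comp_zero]

theorem ext_congr_right (e : X ≃ₗ[A] Y) (i : ℕ) (hX : Subsingleton (Ext A i I X)) :
    Subsingleton (Ext A i I Y) := by
  refine subsingleton_of_forall_eq 0 fun y => ?_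
  have : y = (y.comp (Abelian.Ext.mk₀ e.toModuleIso.inv) (add_zero i)).comp
      (Abelian.Ext.mk₀ e.toModuleIso.hom) (add_zero i) := by
    rw [Abelian.Ext.comp_assoc_of_third_deg_zero, Abelian.Ext.mk₀_comp_mk₀, Iso.inv_hom_id,
      Abelian.Ext.comp_mk₀_id]
  rw [this, hX.elim (Abelian.Ext.comp y _ _) 0, Abelian.Ext.zero_comp]

theorem ext_pi_subsingleton (i : ℕ) (hX : Subsingleton (Ext A i X I)) (k : ℕ) :
    Subsingleton (Ext A i (Fin k → X) I) := by
  induction k with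
  | zero =>
    have : Limits.IsZero (ModuleCat.of A (Fin 0 → X)) :=
      ModuleCat.isZero_of_subsingleton _
    refine subsingleton_of_forall_eq 0 fun y => ?_
    rw [← Abelian.Ext.mk₀_id_comp y, this.eq_of_src (𝟙 _) 0, Abelian.Ext.mk₀_zero,
      Abelian.Ext.zero_comp]
  | succ k ih =>
    refine ext_congr_left I (Fin.consLinearEquiv A (fun _ : Fin (k + 1) => X)) i ?_
    exact ext_subsingleton_middle I (f := LinearMap.inl A X (Fin k → X))
      (g := LinearMap.snd A X (Fin k → X)) LinearMap.inl_injective LinearMap.snd_surjective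
      Function.Exact.inl_snd hX ih

end ExtShortExact

/-! ### Closure properties of modules of type $FP_n$ -/

section FinitePresentation

variable (A : Type u) [Ring A]

/-- `U` has a partial resolution of length `n` by finitely generated free modules, defined
recursively: some `A ^ k` surjects onto `U` with kernel of type `FP (n - 1)`. -/
def FP : ℕ → ∀ (U : Type u) [AddCommGroup U] [Module A U], Prop
  | 0, U, _, _ => ∃ (k : ℕ) (ε : (Fin k → A) →ₗ[A] U), Function.Surjective ε
  | n + 1, U, _, _ => ∃ (k : ℕ) (ε : (Fin k → A) →ₗ[A] U), Function.Surjective ε ∧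
      FP n (LinearMap.ker ε)

variable {A}

theorem FP.congr {n : ℕ} {U V : Type u} [AddCommGroup U] [Module A U] [AddCommGroup V] [Module A V]
    (e : U ≃ₗ[A] V) (h : FP A n U) : FP A n V := by
  cases n with
  | zero =>
    obtain ⟨k, ε, hε⟩ := h
    exact ⟨k, e.toLinearMap ∘ₗ ε, e.surjective.comp hε⟩
  | succ n =>
    obtain ⟨k, ε, hε, hk⟩ := h
    refine ⟨k, e.toLinearMap ∘ₗ ε, e.surjective.comp hε, ?_⟩
    rwa [LinearEquiv.ker_comp]

theorem FP.free (n k : ℕ) : FP A n (Fin k → A) := by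
  induction n generalizing k with
  | zero => exact ⟨k, LinearMap.id, Function.surjective_id⟩
  | succ n ih =>
    refine ⟨k, LinearMap.id, Function.surjective_id, ?_⟩
    rw [LinearMap.ker_id]
    exact (ih 0).congr (LinearEquiv.ofBijective
      (0 : (Fin 0 → A) →ₗ[A] (⊥ : Submodule A (Fin k → A)))
      ⟨fun _ _ _ => Subsingleton.elim _ _, fun x => ⟨0, Subsingleton.elim _ _⟩⟩)

variable {X Y Z : Type u} [AddCommGroup X] [Module A X] [AddCommGroup Y] [Module A Y]
  [AddCommGroup Z] [Module A Z] {f : X →ₗ[A] Y} {g : Y →ₗ[A] Z}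

/-- The free cover of $Z$ lifts through $g$ by projectivity; the lift and $f\circ a$ together cover
$Y$. -/
theorem exists_horseshoe (hg : Function.Surjective g) (h : Function.Exact f g)
    {k l : ℕ} (a : (Fin k → A) →ₗ[A] X) (c : (Fin l → A) →ₗ[A] Z)
    (ha : Function.Surjective a) (hc : Function.Surjective c) :
    ∃ b : ((Fin k → A) × (Fin l → A)) →ₗ[A] Y, Function.Surjective b ∧
      (∀ p, b (p, 0) = f (a p)) ∧ ∀ p, g (b p) = c p.2 := by
  obtain ⟨c', hc'⟩ := Module.projective_lifting_property g c hg
  have hc'' : ∀ p, g (c' p) = c p := fun p => LinearMap.congr_fun hc' p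
  refine ⟨LinearMap.coprod (f ∘ₗ a) c', fun y => ?_, fun p => by simp, fun p => ?_⟩
  · obtain ⟨q, hq⟩ := hc (g y)
    obtain ⟨x, hx⟩ := (h (y - c' q)).1 (by rw [map_sub, hc'', hq, sub_self])
    obtain ⟨p, rfl⟩ := ha x
    exact ⟨(p, q), by simp [hx]⟩
  · simp [h.apply_apply_eq_zero, hc'']

/-- Horseshoe lemma: the kernels of the three covers again form a short exact sequence, so induction
on the length applies. -/
theorem FP.extension {n : ℕ} (hf : Function.Injective f) (hg : Function.Surjective g)
    (h : Function.Exact f g) (hX : FP A n X) (hZ : FP A n Z) : FP A n Y := by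
  induction n generalizing X Y Z with
  | zero =>
    obtain ⟨k, a, ha⟩ := hX
    obtain ⟨l, c, hc⟩ := hZ
    obtain ⟨b, hb, -⟩ := exists_horseshoe hg h a c ha hc
    let e := (LinearEquiv.sumArrowLequivProdArrow (Fin k) (Fin l) A A).symm.trans
      (LinearEquiv.funCongrLeft A A finSumFinEquiv.symm)
    exact ⟨k + l, b ∘ₗ e.symm.toLinearMap, hb.comp e.symm.surjective⟩
  | succ n ih =>
    obtain ⟨k, a, ha, hak⟩ := hX
    obtain ⟨l, c, hc, hck⟩ := hZ
    obtain ⟨b, hb, hb₁, hb₂⟩ := exists_horseshoe hg h a c ha hc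
    let e := (LinearEquiv.sumArrowLequivProdArrow (Fin k) (Fin l) A A).symm.trans
      (LinearEquiv.funCongrLeft A A finSumFinEquiv.symm)
    refine ⟨k + l, b ∘ₗ e.symm.toLinearMap, hb.comp e.symm.surjective, ?_⟩
    have hker : FP A n (LinearMap.ker b) := by
      let i : LinearMap.ker a →ₗ[A] LinearMap.ker b :=
        (LinearMap.inl A (Fin k → A) (Fin l → A)).restrict (fun p hp => by
          rw [LinearMap.mem_ker] at hp ⊢
          simp [hb₁, hp])
      let q : LinearMap.ker b →ₗ[A] LinearMap.ker c :=
        (LinearMap.snd A (Fin k → A) (Fin l → A)).restrict (fun p hp => by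
          rw [LinearMap.mem_ker] at hp ⊢
          simp [← hb₂, hp])
      refine ih (f := i) (g := q) ?_ ?_ ?_ hak hck
      · intro p p' hpp
        exact Subtype.ext (congrArg (fun z => z.1.1) hpp)
      · rintro ⟨r, hr⟩
        -- The element $b(0,r)$ dies in $Z$, hence equals $f(a(p))$ for some $p$; correcting by $-p$
        -- moves $(0,r)$ into the kernel of $b$.
        obtain ⟨x, hx⟩ := (h (b (0, r))).1 (by rw [hb₂]; exact hr)
        obtain ⟨p, rfl⟩ := ha x
        refine ⟨⟨(-p, r), ?_⟩, rfl⟩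
        have : ((-p, r) : (Fin k → A) × (Fin l → A)) = (0, r) - (p, 0) := by simp
        rw [LinearMap.mem_ker, this, map_sub, hb₁, hx, sub_self]
      · rintro ⟨⟨p, r⟩, hp⟩
        constructor
        · intro hr
          obtain rfl : r = 0 := congrArg Subtype.val hr
          refine ⟨⟨p, ?_⟩, rfl⟩
          rw [LinearMap.mem_ker, hb₁] at hp
          exact hf (by rw [hp, map_zero])
        · rintro ⟨p', hp'⟩
          exact Subtype.ext (congrArg (fun z => z.1.2) hp').symm
    refine hker.congr ?_
    exact (e.submoduleMap (LinearMap.ker b)).trans (LinearEquiv.ofEq _ _ (by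
      ext z
      simp [Submodule.mem_map_equiv]))

theorem FP.pi {n : ℕ} (hX : FP A n X) (k : ℕ) : FP A n (Fin k → X) := by
  induction k with
  | zero =>
    exact (FP.free n 0).congr (LinearEquiv.ofBijective (0 : (Fin 0 → A) →ₗ[A] (Fin 0 → X))
      ⟨fun _ _ _ => Subsingleton.elim _ _, fun x => ⟨0, Subsingleton.elim _ _⟩⟩)
  | succ k ih =>
    refine FP.congr (Fin.consLinearEquiv A (fun _ : Fin (k + 1) => X)) ?_
    exact FP.extension (f := LinearMap.inl A X (Fin k → X))
      (g := LinearMap.snd A X (Fin k → X)) LinearMap.inl_injective LinearMap.snd_surjective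
      Function.Exact.inl_snd hX ih

/-- Cover $Y$ by $b:A^k\to Y$. The kernel of $A^k\to Z$ is an extension of $X\cong\mathrm{im} f$ by
$\ker b$, and both are of type $FP_n$. -/
theorem FP.cokernel {n : ℕ} (hf : Function.Injective f) (hg : Function.Surjective g)
    (h : Function.Exact f g) (hX : FP A n X) (hY : FP A (n + 1) Y) : FP A (n + 1) Z := by
  obtain ⟨k, b, hb, hbk⟩ := hY
  refine ⟨k, g ∘ₗ b, hg.comp hb, ?_⟩
  let i : LinearMap.ker b →ₗ[A] LinearMap.ker (g ∘ₗ b) :=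
    Submodule.inclusion (LinearMap.ker_le_ker_comp b g)
  let e := LinearEquiv.ofInjective f hf
  have hq : ∀ p : LinearMap.ker (g ∘ₗ b),
      (b ∘ₗ (LinearMap.ker (g ∘ₗ b)).subtype) p ∈ LinearMap.range f := fun p => (h _).1 p.2
  let q : LinearMap.ker (g ∘ₗ b) →ₗ[A] LinearMap.range f :=
    (b ∘ₗ (LinearMap.ker (g ∘ₗ b)).subtype).codRestrict _ hq
  refine FP.extension (f := i) (g := q) (Submodule.inclusion_injective _) ?_ ?_ hbk
    (hX.congr e)
  · rintro ⟨_, x, rfl⟩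
    obtain ⟨p, hp⟩ := hb (f x)
    exact ⟨⟨p, by simp [hp, h.apply_apply_eq_zero]⟩, Subtype.ext hp⟩
  · intro p
    constructor
    · intro hp
      exact ⟨⟨p.1, congrArg Subtype.val hp⟩, rfl⟩
    · rintro ⟨p', rfl⟩
      exact Subtype.ext p'.2

theorem FP.isFinitelyPresentedOfLength {n : ℕ} (hX : FP A n X) :
    IsFinitelyPresentedOfLength A n X := by
  induction n generalizing X with
  | zero =>
    obtain ⟨k, ε, hε⟩ := hX
    -- Only $F_0$ matters for length zero; the other ranks and the differentials are filler.
    exact ⟨fun _ => k, fun _ => 0, ε, hε, fun h => absurd h (lt_irrefl _),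
      fun i hi => absurd hi (Nat.not_lt_zero _)⟩
  | succ n ih =>
    obtain ⟨k, ε, hε, hk⟩ := hX
    obtain ⟨k', δ', ε', hε', h0, hs⟩ := ih hk
    -- Splicing: the new $\delta_0$ is the cover of $\ker\varepsilon$ followed by its inclusion.
    refine ⟨fun i => Nat.casesOn i k k',
      fun i => Nat.casesOn i ((LinearMap.ker ε).subtype ∘ₗ ε') δ', ε, hε, fun _ => ?_, ?_⟩
    · intro p
      constructor
      · intro hp
        obtain ⟨q, hq⟩ := hε' ⟨p, hp⟩
        exact ⟨q, congrArg Subtype.val hq⟩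
      · rintro ⟨q, rfl⟩
        exact (ε' q).2
    · rintro (_ | i) hi
      · intro p
        refine Iff.trans ?_ (h0 (by omega) p)
        exact Submodule.coe_eq_zero
      · exact hs i (by omega)

end FinitePresentation

/-! ### Dimension shifting along finite free resolutions -/

section Resolution

variable {A : Type u} [Ring A] {C : Type u} [AddCommGroup C] [Module A C]

/-- The resolution of the first syzygy. -/
def FiniteFreeResolution.shift (F : FiniteFreeResolution A C) :
    FiniteFreeResolution A (LinearMap.ker F.ε) where
  k i := F.k (i + 1)
  δ i := F.δ (i + 1)
  ε := (F.δ 0).codRestrict _ fun p => F.exact_zero.apply_apply_eq_zero p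
  surjective := by
    rintro ⟨p, hp⟩
    obtain ⟨q, hq⟩ := (F.exact_zero p).1 hp
    exact ⟨q, Subtype.ext hq⟩
  exact_zero p := by
    rw [← F.exact_succ 0 p, ← Submodule.coe_eq_zero]
    rfl
  exact_succ i := F.exact_succ (i + 1)

/-- Transport of a resolution along an isomorphism. -/
def FiniteFreeResolution.congr {D : Type u} [AddCommGroup D] [Module A D] (e : C ≃ₗ[A] D)
    (F : FiniteFreeResolution A C) : FiniteFreeResolution A D where
  k := F.k
  δ := F.δ
  ε := e.toLinearMap ∘ₗ F.ε
  surjective := e.surjective.comp F.surjective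
  exact_zero p := by
    rw [← F.exact_zero p]
    simp
  exact_succ := F.exact_succ

theorem exists_factor_of_ker_le {P L Y : Type*} [AddCommGroup P] [Module A P] [AddCommGroup L]
    [Module A L] [AddCommGroup Y] [Module A Y] (q : P →ₗ[A] L) (hq : Function.Surjective q)
    (f : P →ₗ[A] Y) (h : LinearMap.ker q ≤ LinearMap.ker f) : ∃ φ : L →ₗ[A] Y, φ ∘ₗ q = f := by
  refine ⟨Submodule.liftQ _ f h ∘ₗ (q.quotKerEquivOfSurjective hq).symm.toLinearMap, ?_⟩
  ext p
  have : (q.quotKerEquivOfSurjective hq).symm (q p) = Submodule.Quotient.mk p := by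
    rw [LinearEquiv.symm_apply_eq]; rfl
  simp [this]

theorem FiniteFreeResolution.fp (F : FiniteFreeResolution A C) (n : ℕ) : FP A n C := by
  induction n generalizing C with
  | zero => exact ⟨_, F.ε, F.surjective⟩
  | succ n ih => exact ⟨_, F.ε, F.surjective, ih F.shift⟩

theorem FiniteFreeResolution.ext_ker_subsingleton_iff (F : FiniteFreeResolution A C)
    (I : Type u) [AddCommGroup I] [Module A I] (i : ℕ) (hi : 1 ≤ i) :
    Subsingleton (Ext A i (LinearMap.ker F.ε) I) ↔ Subsingleton (Ext A (i + 1) C I) := by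
  have hex : Function.Exact (LinearMap.ker F.ε).subtype F.ε := F.ε.exact_subtype_ker_map
  exact ⟨fun h => ext_subsingleton_right I (Submodule.injective_subtype _) F.surjective hex h
      (ext_subsingleton_of_projective I _ _ (by omega)),
    fun h => ext_subsingleton_left I (Submodule.injective_subtype _) F.surjective hex
      (ext_subsingleton_of_projective I _ _ hi) h⟩

/-- `Ext^{j+1}(C, Y) = 0` in terms of a resolution of `C`. -/
theorem FiniteFreeResolution.ext_subsingleton_iff (F : FiniteFreeResolution A C)
    (Y : Type u) [AddCommGroup Y] [Module A Y] (j : ℕ) :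
    Subsingleton (Ext A (j + 1) C Y) ↔
      ∀ f : (Fin (F.k (j + 1)) → A) →ₗ[A] Y, f ∘ₗ F.δ (j + 1) = 0 → ∃ g, f = g ∘ₗ F.δ j := by
  induction j generalizing C with
  | zero =>
    have hex : Function.Exact (LinearMap.ker F.ε).subtype F.ε := F.ε.exact_subtype_ker_map
    constructor
    · intro h f hf
      -- A cocycle on $F_1$ is a map on $\ker\varepsilon$, and it is a coboundary exactly when that
      -- map extends to $F_0$; the obstruction lies in $\mathrm{Ext}^1(C,Y)$.
      have hle : LinearMap.ker F.shift.ε ≤ LinearMap.ker f := by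
        intro p hp
        obtain ⟨q, rfl⟩ := (F.shift.exact_zero p).1 hp
        exact LinearMap.congr_fun hf q
      obtain ⟨φ, hφ⟩ := exists_factor_of_ker_le F.shift.ε F.shift.surjective f hle
      obtain ⟨g, hg⟩ := exists_extension_of_ext_one Y (Submodule.injective_subtype _)
        F.surjective hex h φ
      refine ⟨g, LinearMap.ext fun p => ?_⟩
      exact ((LinearMap.congr_fun hg (F.shift.ε p)).trans (LinearMap.congr_fun hφ p)).symm
    · intro H
      refine ext_one_subsingleton_of_extension Y (Submodule.injective_subtype _) F.surjective hex
        (ext_subsingleton_of_projective Y _ _ le_rfl) fun φ => ?_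
      obtain ⟨g, hg⟩ := H (φ ∘ₗ F.shift.ε) (LinearMap.ext fun p =>
        (congrArg φ (F.shift.exact_zero.apply_apply_eq_zero p)).trans (map_zero φ))
      refine ⟨g, LinearMap.ext fun p => ?_⟩
      obtain ⟨q, rfl⟩ := F.shift.surjective p
      exact (LinearMap.congr_fun hg q).symm
  | succ j ih =>
    rw [← F.ext_ker_subsingleton_iff Y (j + 1) (by omega)]
    exact ih F.shift

/-- A `d`-th syzygy of a module with a resolution has a resolution, and its `Ext` is obtained by
dimension shifting. -/
theorem FiniteFreeResolution.isSyzygy (F : FiniteFreeResolution A C) (d : ℕ)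
    {K : Type u} [AddCommGroup K] [Module A K] (h : F.IsSyzygy d K) :
    Nonempty (FiniteFreeResolution A K) ∧
      ∀ (I : Type u) [AddCommGroup I] [Module A I] (i : ℕ), 1 ≤ i →
        Subsingleton (Ext A (i + d) C I) → Subsingleton (Ext A i K I) := by
  induction d generalizing C with
  | zero =>
    obtain ⟨e⟩ := h
    exact ⟨⟨F.congr e.symm⟩, fun I _ _ i _ hC => ext_congr_left I e.symm i hC⟩
  | succ d ih =>
    -- The index counts kernels, so one kernel is absorbed by the shift. Only the passage from index
    -- 2 to index 1 changes form: $\ker\delta_0$ becomes the kernel of the shifted augmentation.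
    have h' : F.shift.IsSyzygy d K := by
      match d, h with
      | 0, h => exact h
      | 1, h =>
        obtain ⟨e⟩ := h
        refine ⟨e.trans (LinearEquiv.ofEq _ _ ?_)⟩
        exact (LinearMap.ker_codRestrict _ _ _).symm
      | d + 2, h => exact h
    obtain ⟨h1, h2⟩ := ih F.shift h'
    refine ⟨h1, fun I _ _ i hi hC => h2 I i hi ?_⟩
    exact (F.ext_ker_subsingleton_iff I (i + d) (by omega)).2 hC

end Resolution

/-! ### Character modules and the duality between Tor and Ext -/

section CharacterDual

/-- The character group `Hom_ℤ(F, ℚ/ℤ)` of a left `R`-module `F`, as a right `R`-module. -/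
def CharDual (R : Type u) [Ring R] (F : Type u) [AddCommGroup F] [Module R F] : Type u :=
  F →+ AddCircle (1 : ℚ)

variable (R : Type u) [Ring R] (F : Type u) [AddCommGroup F] [Module R F]

namespace CharDual

noncomputable instance : AddCommGroup (CharDual R F) :=
  inferInstanceAs (AddCommGroup (F →+ AddCircle (1 : ℚ)))

variable {R F}

/-- Evaluation of characters, as a biadditive map. -/
noncomputable def eval : CharDual R F →+ F →+ AddCircle (1 : ℚ) := AddMonoidHom.id _

theorem ext {c c' : CharDual R F} (h : ∀ m, eval c m = eval c' m) : c = c' :=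
  AddMonoidHom.ext h

/-- A character as an element of the dual. -/
noncomputable def of (c : F →+ AddCircle (1 : ℚ)) : CharDual R F := c

theorem eval_of (c : F →+ AddCircle (1 : ℚ)) (m : F) : eval (of c : CharDual R F) m = c m := rfl

noncomputable instance : Module Rᵐᵒᵖ (CharDual R F) where
  smul r c := (eval c).comp (DistribSMul.toAddMonoidHom F r.unop)
  one_smul c := ext fun m => congrArg (eval c) (one_smul R m)
  mul_smul r s c := ext fun m => congrArg (eval c) (mul_smul s.unop r.unop m)
  smul_zero _ := rfl
  smul_add _ _ _ := rfl
  add_smul r s c := ext fun m =>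
    (congrArg (eval c) (add_smul r.unop s.unop m)).trans (map_add (eval c) _ _)
  zero_smul c := ext fun m => (congrArg (eval c) (zero_smul R m)).trans (map_zero (eval c))

theorem smul_eval (r : Rᵐᵒᵖ) (c : CharDual R F) (m : F) :
    eval (r • c) m = eval c (r.unop • m) := rfl

variable {U : Type u} [AddCommGroup U] [Module Rᵐᵒᵖ U] {V : Type u} [AddCommGroup V] [Module Rᵐᵒᵖ V]

/-- The adjunction `Hom_{Rᵒᵖ}(U, F⁺) → (U ⊗_R F)⁺`. -/
noncomputable def uncurry (g : U →ₗ[Rᵐᵒᵖ] CharDual R F) : RTensor R U F →+ AddCircle (1 : ℚ) :=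
  RTensor.lift R (eval.comp g.toAddMonoidHom) fun r x m => by
    simp [smul_eval]

theorem uncurry_tmul (g : U →ₗ[Rᵐᵒᵖ] CharDual R F) (x : U) (m : F) :
    uncurry g (RTensor.tmul R x m) = eval (g x) m := rfl

/-- The adjunction `(U ⊗_R F)⁺ → Hom_{Rᵒᵖ}(U, F⁺)`. -/
noncomputable def curry (c : RTensor R U F →+ AddCircle (1 : ℚ)) : U →ₗ[Rᵐᵒᵖ] CharDual R F where
  toFun x := of
    { toFun := fun m => c (RTensor.tmul R x m)
      map_zero' := by simp [RTensor.tmul]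
      map_add' := fun m m' => by rw [RTensor.tmul_add, map_add] }
  map_add' x y := ext fun m =>
    (congrArg c (RTensor.add_tmul R x y m)).trans (map_add c _ _)
  map_smul' r x := ext fun m => congrArg c (RTensor.smul_tmul R r.unop x m)

theorem uncurry_curry (c : RTensor R U F →+ AddCircle (1 : ℚ)) : uncurry (curry c) = c :=
  RTensor.addHom_ext R fun _ _ => rfl

theorem curry_uncurry (g : U →ₗ[Rᵐᵒᵖ] CharDual R F) : curry (uncurry g) = g := rfl

theorem uncurry_comp (g : V →ₗ[Rᵐᵒᵖ] CharDual R F) (φ : U →ₗ[Rᵐᵒᵖ] V) :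
    uncurry (g ∘ₗ φ) = (uncurry g).comp (RTensor.map R φ) :=
  RTensor.addHom_ext R fun _ _ => rfl

theorem curry_comp (c : RTensor R V F →+ AddCircle (1 : ℚ)) (φ : U →ₗ[Rᵐᵒᵖ] V) :
    curry (c.comp (RTensor.map R φ)) = curry c ∘ₗ φ := rfl

end CharDual

theorem exists_character_ne_zero {B : Type*} [AddCommGroup B] {b : B} (hb : b ≠ 0) :
    ∃ c : B →+ AddCircle (1 : ℚ), c b ≠ 0 :=
  CharacterModule.exists_character_apply_ne_zero_of_ne_zero hb

/-- The character descends to $B/\ker g$, which embeds in $C$; it extends because $\mathbb Q/\mathbb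
Z$ is divisible, hence injective. -/
theorem exists_character_extension {B C : Type*} [AddCommGroup B] [AddCommGroup C] (g : B →+ C)
    (c : B →+ AddCircle (1 : ℚ)) (h : ∀ b, g b = 0 → c b = 0) :
    ∃ e : C →+ AddCircle (1 : ℚ), c = e.comp g := by
  let c' : B ⧸ g.ker →+ AddCircle (1 : ℚ) := QuotientAddGroup.lift _ c h
  obtain ⟨e, he⟩ := (Module.Baer.of_divisible (AddCircle (1 : ℚ))).extension_property_addMonoidHom
    (QuotientAddGroup.kerLift g) (QuotientAddGroup.kerLift_injective g) c'
  refine ⟨e, AddMonoidHom.ext fun b => ?_⟩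
  exact (DFunLike.congr_fun he (QuotientAddGroup.mk b)).symm

/-- A sequence of abelian groups is exact if every character killing the image extends. -/
theorem exists_preimage_of_characters {A B C : Type*} [AddCommGroup A] [AddCommGroup B]
    [AddCommGroup C] (f : A →+ B) (g : B →+ C)
    (h : ∀ c : B →+ AddCircle (1 : ℚ), c.comp f = 0 → ∃ e : C →+ AddCircle (1 : ℚ), c = e.comp g)
    (b : B) (hb : g b = 0) : ∃ a, f a = b := by
  by_contra hne
  have hne' : (QuotientAddGroup.mk b : B ⧸ f.range) ≠ 0 := fun h0 =>
    hne ((QuotientAddGroup.eq_zero_iff b).1 h0)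
  -- A character separates $b$ from the image of $f$. By hypothesis it factors through $g$, so it
  -- vanishes at $b$ after all.
  obtain ⟨c, hc⟩ := exists_character_ne_zero hne'
  obtain ⟨e, he⟩ := h (c.comp (QuotientAddGroup.mk' f.range)) (AddMonoidHom.ext fun a => by
    have : (QuotientAddGroup.mk (f a) : B ⧸ f.range) = 0 :=
      (QuotientAddGroup.eq_zero_iff _).2 ⟨a, rfl⟩
    simp [this])
  apply hc
  have := DFunLike.congr_fun he b
  simpa [hb] using this

variable {U V W : Type u} [AddCommGroup U] [Module Rᵐᵒᵖ U] [AddCommGroup V] [Module Rᵐᵒᵖ V]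
  [AddCommGroup W] [Module Rᵐᵒᵖ W]

variable {R}

/-- Exactness of `U ⊗ F → V ⊗ F → W ⊗ F` is dual to exactness of `Hom(-, F⁺)`. -/
theorem tensor_exact_iff (f : U →ₗ[Rᵐᵒᵖ] V) (g : V →ₗ[Rᵐᵒᵖ] W) :
    (∀ z : RTensor R V F, RTensor.map R g z = 0 → ∃ w, RTensor.map R f w = z) ↔
      ∀ φ : V →ₗ[Rᵐᵒᵖ] CharDual R F, φ ∘ₗ f = 0 → ∃ ψ : W →ₗ[Rᵐᵒᵖ] CharDual R F, φ = ψ ∘ₗ g := by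
  constructor
  · intro H φ hφ
    obtain ⟨e, he⟩ := exists_character_extension (RTensor.map R g) (CharDual.uncurry φ)
      fun z hz => by
        obtain ⟨w, rfl⟩ := H z hz
        rw [← AddMonoidHom.comp_apply, ← CharDual.uncurry_comp, hφ]
        exact DFunLike.congr_fun (RTensor.addHom_ext R (f := CharDual.uncurry 0) (g := 0)
          fun _ _ => rfl) w
    exact ⟨CharDual.curry e, by rw [← CharDual.curry_comp, ← he, CharDual.curry_uncurry]⟩
  · intro H z hz
    refine exists_preimage_of_characters (RTensor.map R f) (RTensor.map R g) (fun c hc => ?_) z hz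
    obtain ⟨ψ, hψ⟩ := H (CharDual.curry c) (by rw [← CharDual.curry_comp, hc]; rfl)
    exact ⟨CharDual.uncurry ψ, by rw [← CharDual.uncurry_comp, ← hψ, CharDual.uncurry_curry]⟩

/-- `Tor_i(U, F) = 0` if and only if `Ext^i(U, F⁺) = 0`. -/
theorem tor_subsingleton_iff (i : ℕ) (hi : 1 ≤ i) :
    Subsingleton (Tor R F i U) ↔ Subsingleton (Ext Rᵐᵒᵖ i U (CharDual R F)) := by
  obtain ⟨n, rfl⟩ := Nat.exists_eq_add_of_le' hi
  let P := projectiveResolution (ModuleCat.of Rᵐᵒᵖ U)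
  have h1 : Subsingleton (Tor R F (n + 1) U) ↔
      (ShortComplex.mk _ _ ((((tensorFunctor R F).mapHomologicalComplex _).obj
        P.complex).d_comp_d (n + 2) (n + 1) n)).Exact := by
    refine Iff.trans ?_ (HomologicalComplex.exactAt_iff' (((tensorFunctor R F).mapHomologicalComplex
      _).obj P.complex) (n + 2) (n + 1) n (by simp) (by simp))
    rw [HomologicalComplex.exactAt_iff_isZero_homology, AddCommGrpCat.isZero_iff_subsingleton]
    exact (P.isoLeftDerivedObj (tensorFunctor R F)
      (n + 1)).addCommGroupIsoToAddEquiv.toEquiv.subsingleton_congr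
  rw [h1, ShortComplex.ab_exact_iff]
  -- Both groups are now read off one projective resolution $P$ of $U$: exactness of $P\otimes F$ in
  -- degree $n+1$ against exactness of $\mathrm{Hom}(P,F^+)$ there.
  have h2 := tensor_exact_iff F (P.complex.d (n + 2) (n + 1)).hom (P.complex.d (n + 1) n).hom
  refine Iff.trans h2 ?_
  constructor
  · intro H
    refine subsingleton_of_forall_eq 0 fun x => ?_
    obtain ⟨f, hf, rfl⟩ := P.extMk_surjective x (n + 2) rfl
    rw [P.extMk_eq_zero_iff f _ _ _ n rfl]
    obtain ⟨ψ, hψ⟩ := H f.hom (congrArg ModuleCat.Hom.hom hf)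
    exact ⟨ModuleCat.ofHom ψ, by ext x; exact (LinearMap.congr_fun hψ x).symm⟩
  · intro H φ hφ
    have hf : P.complex.d (n + 2) (n + 1) ≫ ModuleCat.ofHom φ = 0 := by
      ext x; exact LinearMap.congr_fun hφ x
    obtain ⟨g, hg⟩ := (P.extMk_eq_zero_iff _ (n + 2) rfl hf n rfl).1 (H.elim _ _)
    exact ⟨g.hom, (congrArg ModuleCat.Hom.hom hg).symm⟩

end CharacterDual

/-! ### Coresolving the base ring by powers of $K$ -/

section Coresolution

variable {A : Type u} [Ring A]

/-- Cuts a long exact sequence into the short ones $0\to\mathrm{im} f\to Y\to\mathrm{im} g\to0$. -/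
theorem exact_subtype_rangeRestrict {X Y : Type u} [AddCommGroup X] [Module A X] [AddCommGroup Y]
    [Module A Y] (f : X →ₗ[A] Y) {Z : Type u} [AddCommGroup Z] [Module A Z] (g : Y →ₗ[A] Z)
    (h : Function.Exact f g) : Function.Exact (LinearMap.range f).subtype g.rangeRestrict := by
  intro y
  rw [← Submodule.coe_eq_zero]
  refine (h y).trans ?_
  exact ⟨fun hy => ⟨⟨y, hy⟩, rfl⟩, fun ⟨z, hz⟩ => hz ▸ z.2⟩

/-- An exact sequence `0 → X₀ → X₁ → ⋯` whose terms have type `FP_∞` and are acyclic for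
`Hom(-, I)` from degree one on remains exact under `Hom(-, I)`, provided that `Ext^{d+1}(-, I)`
vanishes on modules of type `FP_∞`. -/
theorem exists_extension_of_exact_sequence (I : Type u) [AddCommGroup I] [Module A I] (d : ℕ)
    (hI : ∀ (U : Type u) [AddCommGroup U] [Module A U], (∀ n, FP A n U) →
      Subsingleton (Ext A (d + 1) U I))
    (X : ℕ → Type u) [∀ j, AddCommGroup (X j)] [∀ j, Module A (X j)]
    (f : ∀ j, X j →ₗ[A] X (j + 1)) (h0 : Function.Injective (f 0))
    (hf : ∀ j, Function.Exact (f j) (f (j + 1))) (hX : ∀ j n, FP A n (X j))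
    (hXI : ∀ j i, 1 ≤ i → Subsingleton (Ext A i (X (j + 1)) I))
    (j : ℕ) (φ : X j →ₗ[A] I) (hφ : LinearMap.ker (f j) ≤ LinearMap.ker φ) :
    ∃ ψ : X (j + 1) →ₗ[A] I, φ = ψ ∘ₗ f j := by
  have hex := fun j => exact_subtype_rangeRestrict (f j) (f (j + 1)) (hf j)
  have hfp : ∀ j n, FP A n (LinearMap.range (f j)) := by
    intro j
    induction j with
    | zero => exact fun n => (hX 0 n).congr (LinearEquiv.ofInjective (f 0) h0)
    | succ j ih =>
      have key : ∀ n, FP A (n + 1) (LinearMap.range (f (j + 1))) := fun n =>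
        FP.cokernel (Submodule.injective_subtype _) (LinearMap.surjective_rangeRestrict _) (hex j)
          (ih n) (hX (j + 1) (n + 1))
      rintro (_ | n)
      · obtain ⟨k, ε, hε, -⟩ := key 0
        exact ⟨k, ε, hε⟩
      · exact key n
  -- Each step down in degree costs one step to the right in the sequence. This is affordable since
  -- the sequence is infinite and $\mathrm{Ext}^{d+1}$ vanishes on all images; $i\le d$ keeps the
  -- degree at least one.
  have hext : ∀ i ≤ d, ∀ j, Subsingleton (Ext A (d + 1 - i) (LinearMap.range (f j)) I) := by
    intro i hi
    induction i with
    | zero => exact fun j => hI _ (hfp j)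
    | succ i ih =>
      intro j
      have := ih (by omega) (j + 1)
      rw [show d + 1 - i = d + 1 - (i + 1) + 1 by omega] at this
      exact ext_subsingleton_left I (Submodule.injective_subtype _)
        (LinearMap.surjective_rangeRestrict _) (hex j) (hXI j _ (by omega)) this
  have hone : Subsingleton (Ext A 1 (LinearMap.range (f (j + 1))) I) := by
    have := hext d le_rfl (j + 1)
    rwa [show d + 1 - d = 1 by omega] at this
  -- The map lives on $\mathrm{im} f_j$, and extending it to $X_{j+1}$ is obstructed by
  -- $\mathrm{Ext}^1(\mathrm{im} f_{j+1},I)=0$.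
  obtain ⟨φ', hφ'⟩ := exists_factor_of_ker_le (f j).rangeRestrict
    (LinearMap.surjective_rangeRestrict _) φ (by rwa [LinearMap.ker_rangeRestrict])
  obtain ⟨ψ, hψ⟩ := exists_extension_of_ext_one I (Submodule.injective_subtype _)
    (LinearMap.surjective_rangeRestrict _) (hex j) hone φ'
  refine ⟨ψ, ?_⟩
  rw [← hφ', ← hψ]
  rfl

variable {B : Type u} [Ring B] {K : Type u} [AddCommGroup K] [Module A K] [Module B K]
  [SMulCommClass A B K]

/-- Precomposition with an `A`-linear map, as a `B`-linear map between groups of `A`-linear maps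
to an `(A, B)`-bimodule. -/
def precomp (B : Type u) [Ring B] (K : Type u) [AddCommGroup K] [Module A K] [Module B K]
    [SMulCommClass A B K] {P Q : Type u} [AddCommGroup P] [Module A P] [AddCommGroup Q] [Module A Q]
    (δ : P →ₗ[A] Q) : (Q →ₗ[A] K) →ₗ[B] (P →ₗ[A] K) where
  toFun φ := φ ∘ₗ δ
  map_add' _ _ := rfl
  map_smul' _ _ := rfl

/-- The sequence `B → Hom_A(P₀, K) → Hom_A(P₁, K) → ⋯`: the terms. -/
def CoresX (B : Type u) (F : FiniteFreeResolution A K) (j : ℕ) : Type u :=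
  Nat.casesOn j B fun i => (Fin (F.k i) → A) →ₗ[A] K

noncomputable instance (F : FiniteFreeResolution A K) (j : ℕ) : AddCommGroup (CoresX B F j) :=
  match j with
  | 0 => inferInstanceAs (AddCommGroup B)
  | i + 1 => inferInstanceAs (AddCommGroup ((Fin (F.k i) → A) →ₗ[A] K))

noncomputable instance (F : FiniteFreeResolution A K) (j : ℕ) : Module B (CoresX B F j) :=
  match j with
  | 0 => inferInstanceAs (Module B B)
  | i + 1 => inferInstanceAs (Module B ((Fin (F.k i) → A) →ₗ[A] K))

/-- The sequence `B → Hom_A(P₀, K) → Hom_A(P₁, K) → ⋯`: the maps. -/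
noncomputable def coresMap (B : Type u) [Ring B] [Module B K] [SMulCommClass A B K]
    (F : FiniteFreeResolution A K) (j : ℕ) : CoresX B F j →ₗ[B] CoresX B F (j + 1) :=
  match j with
  | 0 => LinearMap.toSpanSingleton B ((Fin (F.k 0) → A) →ₗ[A] K) F.ε
  | i + 1 => precomp B K (F.δ i)

/-- `Hom_A(A ^ k, K) ≅ K ^ k`. -/
noncomputable def piHomEquiv (B : Type u) [Ring B] (K : Type u) [AddCommGroup K] [Module A K]
    [Module B K] [SMulCommClass A B K] (k : ℕ) :
    (Fin k → K) ≃ₗ[B] ((Fin k → A) →ₗ[A] K) :=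
  (Pi.basisFun A (Fin k)).constr B

/-- If `0 → B → Hom_A(P₀, K) → Hom_A(P₁, K) → ⋯` is exact, because the homothety map
`B → Hom_A(K, K)` is bijective and `Ext_A^i(K, K) = 0`, then it remains exact under `Hom_B(-, I)`
for suitable `I`. -/
theorem cores_dual_exact (F : FiniteFreeResolution A K) (hfp : ∀ n, FP B n K)
    (hinj : ∀ b : B, (∀ x : K, b • x = 0) → b = 0)
    (hsurj : ∀ f : K →ₗ[A] K, ∃ b : B, ∀ x, f x = b • x)
    (hext : ∀ i, 1 ≤ i → Subsingleton (Ext A i K K))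
    (I : Type u) [AddCommGroup I] [Module B I] (d : ℕ)
    (hI : ∀ (U : Type u) [AddCommGroup U] [Module B U], (∀ n, FP B n U) →
      Subsingleton (Ext B (d + 1) U I))
    (hKI : ∀ i, 1 ≤ i → Subsingleton (Ext B i K I)) :
    (∀ y : I, ∃ g : ((Fin (F.k 0) → A) →ₗ[A] K) →ₗ[B] I, g F.ε = y) ∧
    (∀ g : ((Fin (F.k 0) → A) →ₗ[A] K) →ₗ[B] I, g F.ε = 0 →
      ∃ g' : ((Fin (F.k 1) → A) →ₗ[A] K) →ₗ[B] I, g = g' ∘ₗ precomp B K (F.δ 0)) ∧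
    ∀ j, ∀ g : ((Fin (F.k (j + 1)) → A) →ₗ[A] K) →ₗ[B] I, g ∘ₗ precomp B K (F.δ j) = 0 →
      ∃ g' : ((Fin (F.k (j + 2)) → A) →ₗ[A] K) →ₗ[B] I, g = g' ∘ₗ precomp B K (F.δ (j + 1)) := by
  have h0 : Function.Injective (coresMap B F 0) := by
    rw [injective_iff_map_eq_zero]
    intro (b : B) hb
    refine hinj b fun x => ?_
    obtain ⟨p, rfl⟩ := F.surjective x
    exact LinearMap.congr_fun (show b • F.ε = 0 from hb) p
  -- At $\mathrm{Hom}(P_0,K)$, a map killed by $\delta_0$ is an endomorphism of $K$ composed with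
  -- $\varepsilon$, hence a homothety. Further right, exactness is $\mathrm{Ext}^{j+1}(K,K)=0$.
  have hex : ∀ j, Function.Exact (coresMap B F j) (coresMap B F (j + 1)) := by
    rintro (_ | j) φ
    · constructor
      · intro hφ
        obtain ⟨f, hf⟩ := exists_factor_of_ker_le F.ε F.surjective φ (by
          intro p hp
          obtain ⟨q, rfl⟩ := (F.exact_zero p).1 hp
          exact LinearMap.congr_fun (show φ ∘ₗ F.δ 0 = 0 from hφ) q)
        obtain ⟨b, hb⟩ := hsurj f
        refine ⟨b, ?_⟩
        rw [← hf]
        exact LinearMap.ext fun p => (hb (F.ε p)).symm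
      · rintro ⟨b, rfl⟩
        let b' : B := b
        refine LinearMap.ext fun p => ?_
        exact (congrArg (fun x => b' • x) (F.exact_zero.apply_apply_eq_zero p)).trans
          (smul_zero _)
    · constructor
      · intro hφ
        obtain ⟨g, hg⟩ := (F.ext_subsingleton_iff K j).1 (hext (j + 1) (by omega)) φ hφ
        exact ⟨g, hg.symm⟩
      · rintro ⟨g, rfl⟩
        let g' : (Fin (F.k j) → A) →ₗ[A] K := g
        refine LinearMap.ext fun p => ?_
        exact (congrArg g' ((F.exact_succ j).apply_apply_eq_zero p)).trans (map_zero g')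
  have key := exists_extension_of_exact_sequence I d hI (CoresX B F) (coresMap B F) h0 hex
    (by
      rintro (_ | j) n
      · exact (FP.free n 1).congr (LinearEquiv.funUnique (Fin 1) B B)
      · exact ((hfp n).pi (F.k j)).congr (piHomEquiv B K (F.k j)))
    (fun j i hi => ext_congr_left I (piHomEquiv B K (F.k j)) i
      (ext_pi_subsingleton I i (hKI i hi) (F.k j)))
  refine ⟨fun y => ?_, fun g hg => ?_, fun j g hg => ?_⟩
  -- An element $y$ of $I$ is the map $b\mapsto by$ on $B$, and $1\in B$ is sent to $\varepsilon$.
  · obtain ⟨g, hg⟩ := key 0 (LinearMap.toSpanSingleton B I y) (by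
      rw [LinearMap.ker_eq_bot.2 h0]; exact bot_le)
    refine ⟨g, ?_⟩
    have := LinearMap.congr_fun hg (1 : B)
    have h1 : coresMap B F 0 (1 : B) = F.ε := one_smul B F.ε
    have h2 : LinearMap.toSpanSingleton B I y (1 : B) = y := one_smul B y
    exact (h2.symm.trans (this.trans (congrArg g h1))).symm
  -- The relevant kernel is $B\varepsilon$, so vanishing at $\varepsilon$ suffices.
  · refine key 1 g fun φ hφ => ?_
    obtain ⟨b, rfl⟩ := (hex 0 φ).1 hφ
    let b' : B := b
    exact (g.map_smul b' F.ε).trans ((congrArg (fun x => b' • x) hg).trans (smul_zero _))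
  · refine key (j + 2) g fun φ hφ => ?_
    obtain ⟨ψ, rfl⟩ := (hex (j + 1) φ).1 hφ
    exact LinearMap.congr_fun hg ψ

end Coresolution

/-! ### Vanishing of $\mathrm{Ext}(K,I)$ for the syzygy $K$ -/

section Syzygy

variable {A : Type u} [Ring A]

/-- The hypothesis concerns degree $d+1$ only, but it applies to all syzygies of $C$, and these
account for the higher degrees. -/
theorem FiniteFreeResolution.ext_subsingleton_add {C : Type u} [AddCommGroup C] [Module A C]
    (F : FiniteFreeResolution A C) (I : Type u) [AddCommGroup I] [Module A I] (d : ℕ)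
    (hI : ∀ (U : Type u) [AddCommGroup U] [Module A U], (∀ n, FP A n U) →
      Subsingleton (Ext A (d + 1) U I)) (i : ℕ) : Subsingleton (Ext A (i + 1 + d) C I) := by
  induction i generalizing C with
  | zero =>
    rw [show 0 + 1 + d = d + 1 by omega]
    exact hI C F.fp
  | succ i ih =>
    rw [show i + 1 + 1 + d = i + 1 + d + 1 by omega]
    exact (F.ext_ker_subsingleton_iff I (i + 1 + d) (by omega)).1 (ih F.shift)

/-- Shifting through $d$ kernels turns degree $i\ge1$ at $K$ into degree $i+d\ge d+1$ at $C$. -/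
theorem FiniteFreeResolution.IsSyzygy.ext_subsingleton {C : Type u} [AddCommGroup C] [Module A C]
    {F : FiniteFreeResolution A C} {d : ℕ} {K : Type u} [AddCommGroup K] [Module A K]
    (h : F.IsSyzygy d K) (I : Type u) [AddCommGroup I] [Module A I]
    (hI : ∀ (U : Type u) [AddCommGroup U] [Module A U], (∀ n, FP A n U) →
      Subsingleton (Ext A (d + 1) U I)) (i : ℕ) (hi : 1 ≤ i) : Subsingleton (Ext A i K I) := by
  obtain ⟨j, rfl⟩ := Nat.exists_eq_add_of_le' hi
  exact (F.isSyzygy d h).2 I (j + 1) hi (F.ext_subsingleton_add I d hI j)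

end Syzygy

/-! ### Evaluation maps on finite free modules -/

section TensorHom

variable (R S : Type u) [Ring R] [Ring S]

/-- The biadditive map `(x, m) ↦ x ⊗ m`. -/
noncomputable def RTensor.tmulHom (K : Type u) [AddCommGroup K] [Module Rᵐᵒᵖ K]
    (M : Type u) [AddCommGroup M] [Module R M] : K →+ M →+ RTensor R K M where
  toFun x :=
    { toFun := fun m => RTensor.tmul R x m
      map_zero' := by simp [RTensor.tmul]
      map_add' := fun m m' => RTensor.tmul_add R x m m' }
  map_zero' := by ext m; simp [RTensor.tmul]
  map_add' x x' := by ext m; exact RTensor.add_tmul R x x' m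

theorem RTensor.map_surjective {K K' : Type u} [AddCommGroup K] [Module Rᵐᵒᵖ K] [AddCommGroup K']
    [Module Rᵐᵒᵖ K'] (M : Type u) [AddCommGroup M] [Module R M] (φ : K →ₗ[Rᵐᵒᵖ] K')
    (hφ : Function.Surjective φ) :
    Function.Surjective (RTensor.map R φ : RTensor R K M →+ RTensor R K' M) := by
  intro z
  induction z using RTensor.induction_on with
  | h0 => exact ⟨0, map_zero _⟩
  | ht x m =>
    obtain ⟨y, rfl⟩ := hφ x
    exact ⟨RTensor.tmul R y m, rfl⟩
  | ha a b ha hb =>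
    obtain ⟨a', rfl⟩ := ha
    obtain ⟨b', rfl⟩ := hb
    exact ⟨a' + b', map_add _ _ _⟩

section PiHom

variable {A B : Type u} [Ring A] [Ring B] {K : Type u} [AddCommGroup K] [Module A K] [Module B K]
  [SMulCommClass A B K]

/-- The map `K → Hom_A(A ^ k, K)`, `x ↦ (p ↦ p_j x)`. -/
noncomputable def coordHom (B : Type u) [Ring B] (K : Type u) [AddCommGroup K] [Module A K]
    [Module B K] [SMulCommClass A B K] (k : ℕ) (j : Fin k) : K →ₗ[B] ((Fin k → A) →ₗ[A] K) where
  toFun x := LinearMap.toSpanSingleton A K x ∘ₗ LinearMap.proj j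
  map_add' x y := by ext; simp
  map_smul' b x := LinearMap.ext fun p => smul_comm (p j) b x

theorem coordHom_apply (k : ℕ) (j : Fin k) (x : K) (p : Fin k → A) :
    coordHom B K k j x p = p j • x := rfl

/-- A map on $A^k$ is recovered from its values on the basis; both inverses constructed below depend
on this. -/
theorem sum_coordHom (k : ℕ) (φ : (Fin k → A) →ₗ[A] K) :
    ∑ j, coordHom B K k j (φ (Pi.single j 1)) = φ := by
  refine LinearMap.ext fun p => ?_
  rw [LinearMap.sum_apply]
  conv_rhs => rw [← Finset.univ_sum_single p, map_sum]
  refine Finset.sum_congr rfl fun j _ => ?_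
  rw [coordHom_apply, ← map_smul]
  congr 1
  rw [← Pi.single_smul, smul_eq_mul, mul_one]

end PiHom

variable (K : Type u) [AddCommGroup K] [Module S K] [Module Rᵐᵒᵖ K] [SMulCommClass S Rᵐᵒᵖ K]

section HomEval

variable [SMulCommClass Rᵐᵒᵖ S K] (I : Type u) [AddCommGroup I] [Module S I]

/-- The map `P ⊗_R Hom_S(K, I) → Hom_S(Hom_{Rᵒᵖ}(P, K), I)`, `p ⊗ f ↦ (φ ↦ f (φ p))`. -/
noncomputable def homEval (P : Type u) [AddCommGroup P] [Module Rᵐᵒᵖ P] :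
    RTensor R P (BHom S K I) →+ ((P →ₗ[Rᵐᵒᵖ] K) →ₗ[S] I) :=
  RTensor.lift R
    { toFun := fun p =>
        { toFun := fun f => (show K →ₗ[S] I from f) ∘ₗ
            { toFun := fun φ : P →ₗ[Rᵐᵒᵖ] K => φ p
              map_add' := fun _ _ => rfl
              map_smul' := fun _ _ => rfl }
          map_zero' := rfl
          map_add' := fun _ _ => rfl }
      map_zero' := by
        ext f φ
        exact (congrArg f (map_zero φ)).trans (LinearMap.map_zero (show K →ₗ[S] I from f))
      map_add' := fun p q => by
        ext f φ
        exact (congrArg f (map_add φ p q)).trans (LinearMap.map_add (show K →ₗ[S] I from f) _ _) }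
    (fun r p f => LinearMap.ext fun φ => congrArg f (map_smul φ (MulOpposite.op r) p))

theorem homEval_naturality {P Q : Type u} [AddCommGroup P] [Module Rᵐᵒᵖ P] [AddCommGroup Q]
    [Module Rᵐᵒᵖ Q] (δ : P →ₗ[Rᵐᵒᵖ] Q) (z : RTensor R P (BHom S K I)) :
    homEval R S K I Q (RTensor.map R δ z) = homEval R S K I P z ∘ₗ precomp S K δ := by
  induction z using RTensor.induction_on with
  | h0 => simp
  | ht p f => rfl
  | ha a b ha hb => simp only [map_add, ha, hb, LinearMap.add_comp]

/-- A map $g$ on $\mathrm{Hom}(R^k,K)\cong K^k$ is determined by its restrictions $g_j$ to the $k$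
slots; the inverse is $g\mapsto\sum_j e_j\otimes g_j$. -/
theorem homEval_bijective (k : ℕ) : Function.Bijective (homEval R S K I (Fin k → Rᵐᵒᵖ)) := by
  let slot (j : Fin k) : (((Fin k → Rᵐᵒᵖ) →ₗ[Rᵐᵒᵖ] K) →ₗ[S] I) →+ BHom S K I :=
    { toFun := fun g => (show K →ₗ[S] I from g ∘ₗ coordHom S K k j)
      map_zero' := rfl
      map_add' := fun _ _ => rfl }
  let σ : (((Fin k → Rᵐᵒᵖ) →ₗ[Rᵐᵒᵖ] K) →ₗ[S] I) →+ RTensor R (Fin k → Rᵐᵒᵖ) (BHom S K I) :=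
    ∑ j, (RTensor.tmulHom R (Fin k → Rᵐᵒᵖ) (BHom S K I) (Pi.single j 1)).comp (slot j)
  have hσ : ∀ g, σ g = ∑ j, RTensor.tmul R (Pi.single j 1) (slot j g) := fun g => by
    simp only [σ, AddMonoidHom.finsetSum_apply]
    rfl
  refine Function.bijective_iff_has_inverse.2 ⟨σ, fun z => ?_, fun g => ?_⟩
  · have : σ.comp (homEval R S K I (Fin k → Rᵐᵒᵖ)) = AddMonoidHom.id _ := by
      refine RTensor.addHom_ext R fun p f => ?_
      rw [AddMonoidHom.comp_apply, hσ]
      have h1 : ∀ j, slot j (homEval R S K I _ (RTensor.tmul R p f)) = (p j).unop • f :=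
        fun j => rfl
      simp only [h1, ← RTensor.smul_tmul]
      have h2 : ∀ q, RTensor.tmul R q f = RTensor.tmulHom R (Fin k → Rᵐᵒᵖ) (BHom S K I) q f :=
        fun _ => rfl
      simp only [h2]
      rw [← AddMonoidHom.finsetSum_apply, ← map_sum]
      refine congrArg (fun q => RTensor.tmul R q f) ?_
      refine (Finset.sum_congr rfl fun j _ => ?_).trans (Finset.univ_sum_single p)
      rw [← Pi.single_smul, smul_eq_mul, mul_one, MulOpposite.op_unop]
    exact DFunLike.congr_fun this z
  · refine LinearMap.ext fun φ => ?_
    rw [hσ, map_sum, LinearMap.sum_apply]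
    have : ∀ j, homEval R S K I _ (RTensor.tmul R (Pi.single j 1) (slot j g)) φ =
      g (coordHom S K k j (φ (Pi.single j 1))) := fun _ => rfl
    simp only [this]
    rw [← map_sum, sum_coordHom]

end HomEval

section TensorEval

variable (F : Type u) [AddCommGroup F] [Module R F]

/-- The map `Hom_S(P, K) ⊗_R F → Hom_S(P, K ⊗_R F)`, `φ ⊗ m ↦ (p ↦ φ p ⊗ m)`. -/
noncomputable def tensorEval (P : Type u) [AddCommGroup P] [Module S P] :
    RTensor R (P →ₗ[S] K) F →+ (P →ₗ[S] RTensor R K F) :=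
  RTensor.lift R
    { toFun := fun φ =>
        { toFun := fun m =>
            { toFun := fun p => RTensor.tmul R (φ p) m
              map_add' := fun p q => by rw [map_add, RTensor.add_tmul]
              map_smul' := fun s p => by rw [map_smul]; rfl }
          map_zero' := LinearMap.ext fun p => map_zero (RTensor.tmulHom R K F (φ p))
          map_add' := fun m m' => LinearMap.ext fun p => RTensor.tmul_add R _ m m' }
      map_zero' := by
        ext m p
        exact DFunLike.congr_fun (map_zero (RTensor.tmulHom R K F)) m
      map_add' := fun φ ψ => by
        ext m p
        exact RTensor.add_tmul R _ _ m }
    (fun r φ m => LinearMap.ext fun p => RTensor.smul_tmul R r (φ p) m)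

theorem tensorEval_naturality {P Q : Type u} [AddCommGroup P] [Module S P] [AddCommGroup Q]
    [Module S Q] (δ : P →ₗ[S] Q) (z : RTensor R (Q →ₗ[S] K) F) :
    tensorEval R S K F P (RTensor.map R (precomp Rᵐᵒᵖ K δ) z) = tensorEval R S K F Q z ∘ₗ δ := by
  induction z using RTensor.induction_on with
  | h0 => simp
  | ht p f => rfl
  | ha a b ha hb => simp only [map_add, ha, hb, LinearMap.add_comp]

/-- The inverse places each value $h(e_j)\in K\otimes F$ in the $j$th slot of
$\mathrm{Hom}(S^k,K)\otimes F$ and sums. -/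
theorem tensorEval_bijective (k : ℕ) : Function.Bijective (tensorEval R S K F (Fin k → S)) := by
  let slot (j : Fin k) : ((Fin k → S) →ₗ[S] RTensor R K F) →+ RTensor R K F :=
    { toFun := fun h => h (Pi.single j 1)
      map_zero' := rfl
      map_add' := fun _ _ => rfl }
  let σ : ((Fin k → S) →ₗ[S] RTensor R K F) →+ RTensor R ((Fin k → S) →ₗ[S] K) F :=
    ∑ j, (RTensor.map R (coordHom Rᵐᵒᵖ K k j)).comp (slot j)
  have hσ : ∀ h, σ h = ∑ j, RTensor.map R (coordHom Rᵐᵒᵖ K k j) (h (Pi.single j 1)) := fun g => by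
    simp only [σ, AddMonoidHom.finsetSum_apply]
    rfl
  refine Function.bijective_iff_has_inverse.2 ⟨σ, fun z => ?_, fun h => ?_⟩
  · have : σ.comp (tensorEval R S K F (Fin k → S)) = AddMonoidHom.id _ := by
      refine RTensor.addHom_ext R fun φ m => ?_
      rw [AddMonoidHom.comp_apply, hσ]
      have h1 : ∀ j, RTensor.map R (coordHom Rᵐᵒᵖ K k j)
          (tensorEval R S K F (Fin k → S) (RTensor.tmul R φ m) (Pi.single j 1)) =
          RTensor.tmulHom R ((Fin k → S) →ₗ[S] K) F
            (coordHom Rᵐᵒᵖ K k j (φ (Pi.single j 1))) m := fun _ => rfl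
      simp only [h1]
      rw [← AddMonoidHom.finsetSum_apply, ← map_sum, sum_coordHom]
      rfl
    exact DFunLike.congr_fun this z
  · refine LinearMap.ext fun p => ?_
    rw [hσ, map_sum, LinearMap.sum_apply]
    have h1 : ∀ (j : Fin k) (z : RTensor R K F),
        tensorEval R S K F (Fin k → S) (RTensor.map R (coordHom Rᵐᵒᵖ K k j) z) p = p j • z := by
      intro j z
      induction z using RTensor.induction_on with
      | h0 => simp
      | ht x m => rfl
      | ha a b ha hb => simp only [map_add, LinearMap.add_apply, ha, hb, smul_add]
    simp only [h1]
    conv_rhs => rw [← Finset.univ_sum_single p, map_sum]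
    refine Finset.sum_congr rfl fun j _ => ?_
    rw [← map_smul, ← Pi.single_smul, smul_eq_mul, mul_one]

end TensorEval

end TensorHom

/-! ### Invariance under isomorphism and the Foxby equivalence -/

section Transport

variable {R S : Type u} [Ring R] [Ring S]

/-- `K ⊗_R M ≅ K ⊗_R M'` for `M ≅ M'`, additively. -/
noncomputable def RTensor.mapRight (K : Type u) [AddCommGroup K] [Module Rᵐᵒᵖ K]
    {M M' : Type u} [AddCommGroup M] [Module R M] [AddCommGroup M'] [Module R M']
    (e : M →ₗ[R] M') : RTensor R K M →+ RTensor R K M' :=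
  RTensor.lift R ((AddMonoidHom.compHom.flip e.toAddMonoidHom).comp (RTensor.tmulHom R K M'))
    fun r x m => by
      change RTensor.tmul R _ (e m) = RTensor.tmul R x (e (r • m))
      rw [RTensor.smul_tmul, map_smul]

theorem RTensor.mapRight_tmul {K : Type u} [AddCommGroup K] [Module Rᵐᵒᵖ K]
    {M M' : Type u} [AddCommGroup M] [Module R M] [AddCommGroup M'] [Module R M']
    (e : M →ₗ[R] M') (x : K) (m : M) :
    RTensor.mapRight K e (RTensor.tmul R x m) = RTensor.tmul R x (e m) := rfl

variable (S) (K : Type u) [AddCommGroup K] [Module S K] [Module Rᵐᵒᵖ K] [SMulCommClass S Rᵐᵒᵖ K]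
variable {M M' : Type u} [AddCommGroup M] [Module R M] [AddCommGroup M'] [Module R M']
variable {N N' : Type u} [AddCommGroup N] [Module S N] [AddCommGroup N'] [Module S N']

/-- `K ⊗_R M ≅ K ⊗_R M'` for `M ≅ M'`, as left `S`-modules. -/
noncomputable def RTensor.congrRight (e : M ≃ₗ[R] M') : RTensor R K M ≃ₗ[S] RTensor R K M' where
  toFun := RTensor.mapRight K e.toLinearMap
  invFun := RTensor.mapRight K e.symm.toLinearMap
  map_add' := map_add _
  map_smul' s z := by
    induction z using RTensor.induction_on with
    | h0 => simp
    | ht x m => rfl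
    | ha a b ha hb => simp only [smul_add, map_add, ha, hb]
  left_inv z := by
    induction z using RTensor.induction_on with
    | h0 => simp
    | ht x m => simp [RTensor.mapRight_tmul]
    | ha a b ha hb => simp only [map_add, ha, hb]
  right_inv z := by
    induction z using RTensor.induction_on with
    | h0 => simp
    | ht x m => simp [RTensor.mapRight_tmul]
    | ha a b ha hb => simp only [map_add, ha, hb]

variable (R) {S}

/-- `Hom_S(K, N) ≅ Hom_S(K, N')` for `N ≅ N'`, as left `R`-modules. -/
def BHom.congrRight (e : N ≃ₗ[S] N') : BHom S K N ≃ₗ[R] BHom S K N' where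
  toFun f := (show K →ₗ[S] N' from e.toLinearMap ∘ₗ (show K →ₗ[S] N from f))
  invFun f := (show K →ₗ[S] N from e.symm.toLinearMap ∘ₗ (show K →ₗ[S] N' from f))
  map_add' _ _ := LinearMap.ext fun _ => map_add e _ _
  map_smul' _ _ := rfl
  left_inv _ := LinearMap.ext fun _ => e.symm_apply_apply _
  right_inv _ := LinearMap.ext fun _ => e.apply_symm_apply _

variable {R}

/-- Isomorphic modules have isomorphic character modules. -/
noncomputable def CharDual.congr (e : M ≃ₗ[R] M') : CharDual R M ≃ₗ[Rᵐᵒᵖ] CharDual R M' where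
  toFun c := CharDual.of ((CharDual.eval c).comp e.symm.toAddMonoidHom)
  invFun c := CharDual.of ((CharDual.eval c).comp e.toAddMonoidHom)
  map_add' _ _ := rfl
  map_smul' r c := CharDual.ext fun m => congrArg (CharDual.eval c) (e.symm.map_smul r.unop m).symm
  left_inv c := CharDual.ext fun m => congrArg (CharDual.eval c) (e.symm_apply_apply m)
  right_inv c := CharDual.ext fun m => congrArg (CharDual.eval c) (e.apply_symm_apply m)

/-- Tor is derived in its other variable, so invariance in $M$ is read off from Ext into character
modules. -/
theorem tor_congr (e : M ≃ₗ[R] M') {U : Type u} [AddCommGroup U] [Module Rᵐᵒᵖ U] (i : ℕ)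
    (hi : 1 ≤ i) (h : Subsingleton (Tor R M i U)) : Subsingleton (Tor R M' i U) := by
  rw [tor_subsingleton_iff _ i hi] at h ⊢
  exact ext_congr_right U (CharDual.congr e) i h

theorem IsNDInjective.congr {n d : ℕ} (e : N ≃ₗ[S] N') (h : IsNDInjective S n d N) :
    IsNDInjective S n d N' :=
  fun U _ _ hU => ext_congr_right U e _ (h U hU)

theorem IsNDFlat.congr {n d : ℕ} (e : M ≃ₗ[R] M') (h : IsNDFlat R n d M) : IsNDFlat R n d M' :=
  fun U _ _ hU => tor_congr e _ (by omega) (h U hU)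

variable {K}

theorem InAuslanderClass.congr (e : M ≃ₗ[R] M') (h : InAuslanderClass S R K M) :
    InAuslanderClass S R K M' where
  A₁ i hi := tor_congr e i hi (h.A₁ i hi)
  A₂ i hi := ext_congr_right K (RTensor.congrRight S K e) i (h.A₂ i hi)
  A₃ := by
    have : ⇑(evalMu R S K M') =
        BHom.congrRight R K (RTensor.congrRight S K e) ∘ evalMu R S K M ∘ e.symm := by
      funext m
      refine LinearMap.ext fun x => ?_
      change RTensor.tmul R x m = RTensor.tmul R x (e (e.symm m))
      rw [e.apply_symm_apply]
    rw [this]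
    exact (LinearEquiv.bijective _).comp (h.A₃.comp e.symm.bijective)

theorem InBassClass.congr (e : N ≃ₗ[S] N') (h : InBassClass S R K N) : InBassClass S R K N' where
  B₁ i hi := ext_congr_right K e i (h.B₁ i hi)
  B₂ i hi := tor_congr (BHom.congrRight R K e) i hi (h.B₂ i hi)
  B₃ := by
    have : ⇑(evalNu R S K N') =
        e ∘ evalNu R S K N ∘ (RTensor.congrRight S K (BHom.congrRight R K e)).symm := by
      funext z
      obtain ⟨w, rfl⟩ := (RTensor.congrRight S K (BHom.congrRight R K e)).surjective z
      simp only [Function.comp_apply, LinearEquiv.symm_apply_apply]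
      induction w using RTensor.induction_on with
      | h0 => simp
      | ht x f => rfl
      | ha a b ha hb => simp only [map_add, ha, hb]
    rw [this]
    exact e.bijective.comp (h.B₃.comp (LinearEquiv.bijective _))

/-- If `I` lies in the Bass class then `Hom_S(K, I)` lies in the Auslander class. -/
theorem InBassClass.inAuslanderClass_hom (h : InBassClass S R K N) :
    InAuslanderClass S R K (BHom S K N) where
  A₁ := h.B₂
  A₂ i hi := ext_congr_right K (LinearEquiv.ofBijective _ h.B₃).symm i (h.B₁ i hi)
  A₃ := by
    -- Triangle identity: $\mathrm{Hom}(K,\nu)\circ\mu=\mathrm{id}$, so $\mu$ is the inverse of an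
    -- isomorphism.
    let e := BHom.congrRight R K (LinearEquiv.ofBijective _ h.B₃)
    have : ⇑(evalMu R S K (BHom S K N)) = e.symm := by
      funext f
      rw [LinearEquiv.eq_symm_apply]
      rfl
    rw [this]
    exact e.symm.bijective

/-- If `F` lies in the Auslander class then `K ⊗_R F` lies in the Bass class. -/
theorem InAuslanderClass.inBassClass_tensor (h : InAuslanderClass S R K M) :
    InBassClass S R K (RTensor R K M) where
  B₁ := h.A₂
  B₂ i hi := tor_congr (LinearEquiv.ofBijective _ h.A₃) i hi (h.A₁ i hi)
  B₃ := by
    -- The other triangle identity: $\nu\circ(K\otimes\mu)=\mathrm{id}$.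
    let e := RTensor.congrRight S K (LinearEquiv.ofBijective _ h.A₃)
    have : ⇑(evalNu R S K (RTensor R K M)) = e.symm := by
      funext z
      obtain ⟨w, rfl⟩ := e.surjective z
      rw [LinearEquiv.symm_apply_apply]
      induction w using RTensor.induction_on with
      | h0 => simp
      | ht x f => rfl
      | ha a b ha hb => simp only [map_add, ha, hb]
    rw [this]
    exact e.symm.bijective

end Transport

/-! ### The two inclusions and the proposition -/

section Main

variable {R S : Type u} [Ring R] [Ring S] {n d : ℕ}
  {C : Type u} [AddCommGroup C] [Module S C] [Module Rᵐᵒᵖ C] [SMulCommClass S Rᵐᵒᵖ C]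
  {K : Type u} [AddCommGroup K] [Module S K] [Module Rᵐᵒᵖ K] [SMulCommClass S Rᵐᵒᵖ K]

theorem RTensor.map_map_eq_zero {U V W : Type u} [AddCommGroup U] [Module Rᵐᵒᵖ U]
    [AddCommGroup V] [Module Rᵐᵒᵖ V] [AddCommGroup W] [Module Rᵐᵒᵖ W] {f : U →ₗ[Rᵐᵒᵖ] V}
    {g : V →ₗ[Rᵐᵒᵖ] W} {M : Type u} [AddCommGroup M] [Module R M] (z : RTensor R U M)
    (h : ∀ x, g (f x) = 0) : RTensor.map R g (RTensor.map R f z) = 0 := by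
  induction z using RTensor.induction_on with
  | h0 => simp
  | ht x m =>
    rw [RTensor.map_tmul, RTensor.map_tmul, h]
    exact DFunLike.congr_fun (map_zero (RTensor.tmulHom R W M)) m
  | ha a b ha hb => simp only [map_add, ha, hb, add_zero]

/-- Via `homEval`, the dualized coresolution of $S$ becomes $\cdots\to
P_1\otimes\mathrm{Hom}(K,I)\to P_0\otimes\mathrm{Hom}(K,I)\to I\to0$. Its exactness gives the Tor
vanishing and makes $\nu$ bijective. -/
theorem IsNDInjective.inBassClass (hK : IsSpecialSemidualizing S R K d C)
    {I : Type u} [AddCommGroup I] [Module S I] (hI : IsNDInjective S n d I) :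
    InBassClass S R K I := by
  obtain ⟨FS, hFS⟩ := hK.left
  obtain ⟨FR, hFR⟩ := hK.right
  obtain ⟨GS⟩ := (FS.isSyzygy d hFS).1
  obtain ⟨G⟩ := (FR.isSyzygy d hFR).1
  have : SMulCommClass Rᵐᵒᵖ S K := SMulCommClass.symm S Rᵐᵒᵖ K
  have hI' : ∀ (U : Type u) [AddCommGroup U] [Module S U], (∀ m, FP S m U) →
      Subsingleton (Ext S (d + 1) U I) := fun U _ _ hU => hI U (hU n).isFinitelyPresentedOfLength
  have hKI := hFS.ext_subsingleton I hI'
  obtain ⟨E0, E1, E2⟩ := cores_dual_exact (A := Rᵐᵒᵖ) (B := S) G GS.fp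
    (fun s hs => hK.semidualizing.b₁.1 (a₂ := 0) (LinearMap.ext fun x =>
      (hs x).trans (zero_smul S x).symm))
    (fun f => by
      obtain ⟨s, hs⟩ := hK.semidualizing.b₁.2 f
      exact ⟨s, fun x => (LinearMap.congr_fun hs x).symm⟩)
    hK.semidualizing.c₂ I d hI' hKI
  have hbij := fun k => homEval_bijective R S K I k
  -- Evaluation at $\varepsilon$, the last map of the dualized sequence, is
  -- $\nu\circ(\varepsilon\otimes\mathrm{id})$.
  have hnu : ∀ z, evalNu R S K I (RTensor.map R G.ε z) = homEval R S K I _ z G.ε := by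
    intro z
    induction z using RTensor.induction_on with
    | h0 => simp
    | ht x f => rfl
    | ha a b ha hb => simp only [map_add, ha, hb, LinearMap.add_apply]
  refine ⟨hKI, fun i hi => ?_, ?_, fun y => ?_⟩
  · obtain ⟨j, rfl⟩ := Nat.exists_eq_add_of_le' hi
    -- The detour through Ext into the character module lets Tor be computed with the chosen finite
    -- free resolution of $K_R$.
    rw [tor_subsingleton_iff _ _ hi, G.ext_subsingleton_iff, ← tensor_exact_iff]
    intro z hz
    obtain ⟨g', hg'⟩ := E2 j (homEval R S K I _ z) (by rw [← homEval_naturality, hz, map_zero])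
    obtain ⟨z', rfl⟩ := (hbij _).2 g'
    rw [← homEval_naturality] at hg'
    exact ⟨z', ((hbij _).1 hg').symm⟩
  · rw [injective_iff_map_eq_zero]
    intro w hw
    obtain ⟨z, rfl⟩ := RTensor.map_surjective R (BHom S K I) G.ε G.surjective w
    rw [hnu] at hw
    obtain ⟨g', hg'⟩ := E1 _ hw
    obtain ⟨z', rfl⟩ := (hbij _).2 g'
    rw [← homEval_naturality] at hg'
    rw [(hbij _).1 hg', RTensor.map_map_eq_zero _ G.exact_zero.apply_apply_eq_zero]
  · obtain ⟨g, hg⟩ := E0 y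
    obtain ⟨z, rfl⟩ := (hbij _).2 g
    exact ⟨RTensor.map R G.ε z, (hnu z).trans hg⟩

/-- Exactness under $\mathrm{Hom}(-,F^+)$ is dual to exactness after $\otimes F$. Via `tensorEval`
this makes $0\to F\to\mathrm{Hom}(P_0,K\otimes F)\to\mathrm{Hom}(P_1,K\otimes F)\to\cdots$ exact,
with $P_\bullet$ now resolving ${}_SK$. -/
theorem IsNDFlat.inAuslanderClass (hK : IsSpecialSemidualizing S R K d C)
    {F : Type u} [AddCommGroup F] [Module R F] (hF : IsNDFlat R n d F) :
    InAuslanderClass S R K F := by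
  obtain ⟨FS, hFS⟩ := hK.left
  obtain ⟨FR, hFR⟩ := hK.right
  obtain ⟨G⟩ := (FS.isSyzygy d hFS).1
  obtain ⟨GR⟩ := (FR.isSyzygy d hFR).1
  have hI : ∀ (U : Type u) [AddCommGroup U] [Module Rᵐᵒᵖ U], (∀ m, FP Rᵐᵒᵖ m U) →
      Subsingleton (Ext Rᵐᵒᵖ (d + 1) U (CharDual R F)) := fun U _ _ hU =>
    (tor_subsingleton_iff F _ (by omega)).1 (hF U (hU n).isFinitelyPresentedOfLength)
  have hKF := hFR.ext_subsingleton (CharDual R F) hI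
  obtain ⟨E0, E1, E2⟩ := cores_dual_exact (A := S) (B := Rᵐᵒᵖ) G GR.fp
    (fun r hr => MulOpposite.unop_injective (hK.semidualizing.b₂.1 (a₂ := 0)
      (LinearMap.ext fun x => (hr x).trans (zero_smul Rᵐᵒᵖ x).symm)))
    (fun f => by
      obtain ⟨r, hr⟩ := hK.semidualizing.b₂.2 f
      exact ⟨MulOpposite.op r, fun x => (LinearMap.congr_fun hr x).symm⟩)
    hK.semidualizing.c₁ (CharDual R F) d hI hKF
  have hbij := fun k => tensorEval_bijective R S K F k
  refine ⟨fun i hi => (tor_subsingleton_iff F i hi).2 (hKF i hi), fun i hi => ?_, ?_, fun h => ?_⟩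
  · obtain ⟨j, rfl⟩ := Nat.exists_eq_add_of_le' hi
    rw [G.ext_subsingleton_iff]
    intro f hf
    obtain ⟨z, rfl⟩ := (hbij _).2 f
    rw [← tensorEval_naturality] at hf
    obtain ⟨w, rfl⟩ := (tensor_exact_iff F _ _).2 (E2 j) z ((hbij _).1 (hf.trans (map_zero _).symm))
    exact ⟨_, tensorEval_naturality R S K F (G.δ j) w⟩
  · rw [injective_iff_map_eq_zero]
    intro m hm
    by_contra hne
    obtain ⟨c, hc⟩ := exists_character_ne_zero hne
    -- The character $c$ extends to one on $\mathrm{Hom}(P_0,K)\otimes F$ with $c(m)$ its value at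
    -- $\varepsilon\otimes m$. That tensor is zero because $\mu(m)=0$.
    obtain ⟨g, hg⟩ := E0 (CharDual.of c)
    have hz : RTensor.tmul R G.ε m = 0 := (hbij _).1 (by
      rw [map_zero]
      exact LinearMap.ext fun p => LinearMap.congr_fun hm (G.ε p))
    apply hc
    rw [← CharDual.eval_of (R := R) c m, ← hg, ← CharDual.uncurry_tmul, hz, map_zero]
  · let h' : K →ₗ[S] RTensor R K F := h
    obtain ⟨z, hz⟩ := (hbij _).2 (h' ∘ₗ G.ε)
    have hz0 : RTensor.map R (precomp Rᵐᵒᵖ K (G.δ 0)) z = 0 := (hbij _).1 (by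
      rw [tensorEval_naturality, hz, map_zero]
      exact LinearMap.ext fun p =>
        (congrArg h' (G.exact_zero.apply_apply_eq_zero p)).trans (map_zero h'))
    -- The first term is $F$ itself rather than a tensor product, so `tensor_exact_iff` does not
    -- apply and characters are used directly.
    obtain ⟨m, rfl⟩ := exists_preimage_of_characters
      (RTensor.tmulHom R ((Fin (G.k 0) → S) →ₗ[S] K) F G.ε)
      (RTensor.map R (precomp Rᵐᵒᵖ K (G.δ 0))) (fun c hc => by
        obtain ⟨ψ, hψ⟩ := E1 (CharDual.curry c) (CharDual.ext fun m => DFunLike.congr_fun hc m)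
        exact ⟨CharDual.uncurry ψ, by
          rw [← CharDual.uncurry_comp, ← hψ, CharDual.uncurry_curry]⟩) z hz0
    refine ⟨m, LinearMap.ext fun x => ?_⟩
    obtain ⟨p, rfl⟩ := G.surjective x
    exact LinearMap.congr_fun hz p

end Main

end FoxbyND

theorem mainTheorem7 (R S : Type u) [Ring R] [Ring S] (n d : ℕ) (hd : 1 ≤ d) (hn : d + 1 < n)
    (C : Type u) [AddCommGroup C] [Module S C] [Module Rᵐᵒᵖ C] [SMulCommClass S Rᵐᵒᵖ C]
    (K : Type u) [AddCommGroup K] [Module S K] [Module Rᵐᵒᵖ K] [SMulCommClass S Rᵐᵒᵖ K]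
    (hK : FoxbyND.IsSpecialSemidualizing S R K d C) :
    (∀ (M : Type u) [AddCommGroup M] [Module R M],
      FoxbyND.IsKNDInjective S R K n d M ↔
        FoxbyND.InAuslanderClass S R K M ∧
          FoxbyND.IsNDInjective S n d (FoxbyND.RTensor R K M)) ∧
    (∀ (N : Type u) [AddCommGroup N] [Module S N],
      FoxbyND.IsKNDFlat S R K n d N ↔
        FoxbyND.InBassClass S R K N ∧
          FoxbyND.IsNDFlat R n d (FoxbyND.BHom S K N)) := by
  refine ⟨fun M _ _ => ⟨?_, fun ⟨hM, hI⟩ => ?_⟩, fun N _ _ => ⟨?_, fun ⟨hN, hF⟩ => ?_⟩⟩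
  · rintro ⟨I, _, _, hI, ⟨e⟩⟩
    have hB := hI.inBassClass hK
    exact ⟨hB.inAuslanderClass_hom.congr e.symm,
      (hI.congr (LinearEquiv.ofBijective _ hB.B₃).symm).congr
        (FoxbyND.RTensor.congrRight S K e.symm)⟩
  -- The witness is $K\otimes_R M$, with $\mu$ as the isomorphism.
  · exact ⟨_, _, _, hI, ⟨LinearEquiv.ofBijective _ hM.A₃⟩⟩
  · rintro ⟨F, _, _, hF, ⟨e⟩⟩
    have hA := hF.inAuslanderClass hK
    exact ⟨hA.inBassClass_tensor.congr e.symm,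
      (hF.congr (LinearEquiv.ofBijective _ hA.A₃)).congr
        (FoxbyND.BHom.congrRight R K e.symm)⟩
  -- The witness is $\mathrm{Hom}_S(K,N)$, with $\nu^{-1}$ as the isomorphism.
  · exact ⟨_, _, _, hF, ⟨(LinearEquiv.ofBijective _ hN.B₃).symm⟩⟩
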